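/- Let $N\ge 2$ be an even integer and $\kappa_N=(-1)^{1+N/2}$. For $t>0$ let $p(t;x)$ be the elementary solution of $\partial u/\partial t=\kappa_N\,\partial^N u/\partial x^N$, i.e. the real function with Fourier transform $\int_{\mathbb R}e^{i\mu x}p(t;x)\,dx=e^{\kappa_N t(-i\mu)^N}=e^{-t\mu^N}$, that is, $$p(t;x)=\frac1{2\pi}\int_{\mathbb R}e^{-i\mu x}\,e^{\kappa_N t(-i\mu)^N}\,d\mu .$$ Let $n\ge 0$ be an integer. A tame function of $k$ observations is a bounded Borel function $F:\mathbb R^k\to\mathbb C$; with $x_0=0$, its pseudo-expectation (for the pseudo-process $X$ started at $0$ and observed at the times $1/2^n,\dots,k/2^n$) is $$\mathbb E(F)=\int_{\mathbb R^k}F(x_1,\dots,x_k)\prod_{j=1}^k p(2^{-n};x_{j-1}-x_j)\,dx_1\cdots dx_k .$$ For a real sequence $(x_k)_{k\ge0}$ with $x_0=0$ (the values $x_k=X(k/2^n)$) let $X_n(t)=x_k$ for $t\in[k/2^n,(k+1)/2^n)$, and let $T_n(t)=\int_0^t \mathbf 1_{[0,\infty)}(X_n(s))\,ds$. Let $\lambda\in\mathbb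 C$ with $\Re\lambda>0$, $\mu\in\mathbb R$ and $\nu>0$, and put $$F_n(\lambda,\mu,\nu)=\int_0^\infty e^{-\lambda t+i\mu X_n(t)-\nu T_n(t)}\,dt=\sum_{k=0}^\infty F_{k,n},\qquad F_{k,n}=\int_{k/2^n}^{(k+1)/2^n}e^{-\lambda t+i\mu X_n(t)-\nu T_n(t)}\,dt .$$ Theorem. (i) For every $n$, $F_n(\lambda,\mu,\nu)$ is a function of the discrete observations of $X$ with a well-defined expectation. That is: the integral defining $F_n$ converges absolutely for every sequence; each $F_{k,n}$ is a tame function of $(x_1,\dots,x_k)$ whose pseudo-expectation is an absolutely convergent integral; the series $\sum_k F_{k,n}$ converges to $F_n$ for every sequence with $x_0=0$; and $\sum_{k}|\mathbb E(F_{k,n})|<\infty$. Accordingly set $$E_n(\lambda,\mu,\nu)=\mathbb E\big[F_n(\lambda,\mu,\nu)\big]=\sum_{k=0}^\infty\mathbb E(F_{k,n}).$$ (ii) The limit $E(\lambda,\mu,\nu)=\lim_{n\to\infty}E_n(\lambda,\mu,\nu)$ exists and $$E(\lambda,\mu,\nu)=\frac{1}{\prod_{j\in J}\big((\lambda+\nu)^{1/N}-i\mu\theta_j\big)\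 \prod_{k\in K}\big(\lambda^{1/N}-i\mu\theta_k\big)},$$ where $\theta_1,\dots,\theta_N$ are the $N$-th roots of $\kappa_N$, $J=\{i:\Re\theta_i>0\}$, $K=\{i:\Re\theta_i<0\}$, and the $N$-th roots of $\lambda$ and $\lambda+\nu$ are the principal ones. -/

import Mathlib

open MeasureTheory Filter Topology

noncomputable section

namespace PseudoProcess

/-- The constant `κ_N = (-1)^(1 + N/2)` of the heat-type equation `∂u/∂t = κ_N ∂^N u/∂x^N`
(for even `N`). -/
def kappa (N : ℕ) : ℂ := (-1) ^ (1 + N / 2)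

/-- The elementary solution `p(t; x)` of `∂u/∂t = κ_N ∂^N u/∂x^N`, that is, the function whose
Fourier transform `∫ exp(iμx) p(t; x) dx` is `exp(κ_N t (-iμ)^N)`, written as an inverse
Fourier integral. Its values are real, see `im_kernel`. -/
def kernel (N : ℕ) (t x : ℝ) : ℂ :=
  (1 / (2 * Real.pi) : ℂ) *
    ∫ μ : ℝ, Complex.exp (-(Complex.I * μ * x)) *
      Complex.exp (kappa N * t * (-(Complex.I * μ)) ^ N)

/-- For even `N` the exponent in the kernel is `-t μ^N`. -/
theorem kappa_mul_pow {N : ℕ} (hN : Even N) (μ : ℝ) :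
    kappa N * (-(Complex.I * μ)) ^ N = -((μ ^ N : ℝ) : ℂ) := by
  obtain ⟨m, rfl⟩ := hN
  have h1 : (m + m) / 2 = m := by omega
  have h2 : (-(Complex.I * (μ : ℂ))) ^ (m + m) = (-1) ^ m * (μ : ℂ) ^ (m + m) := by
    rw [← two_mul, pow_mul, neg_sq, mul_pow, Complex.I_sq, mul_pow, pow_mul]
  rw [h2, kappa, h1, ← mul_assoc, ← pow_add]
  have h3 : (-1 : ℂ) ^ (1 + m + m) = -1 := by
    apply Odd.neg_one_pow
    exact ⟨m, by ring⟩
  rw [h3]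
  push_cast
  ring

/-- For even `N` the kernel is real. -/
theorem im_kernel {N : ℕ} (hN : Even N) (t x : ℝ) : (kernel N t x).im = 0 := by
  have e : ∀ s : ℝ, kappa N * t * (-(Complex.I * s)) ^ N = ((-(t * s ^ N) : ℝ) : ℂ) := by
    intro s
    rw [mul_right_comm, kappa_mul_pow hN]
    push_cast
    ring
  rw [← Complex.conj_eq_iff_im, kernel, map_mul, ← integral_conj]
  congr 1
  · simp [Complex.conj_ofNat]
  · rw [← integral_neg_eq_self]
    refine integral_congr_ae (Eventually.of_forall fun μ => ?_)
    simp only [e]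
    simp only [map_mul, ← Complex.exp_conj, hN.neg_pow]
    simp

/-- The sequence `x_0 = 0, x_1, …, x_k` of values at the dyadic times `0, 1/2^n, …, k/2^n` made
from the `k` observations `y = (x_1, …, x_k)`; it is continued by `0`. -/
def pathOf {k : ℕ} (y : Fin k → ℝ) : ℕ → ℝ
  | 0 => 0
  | j + 1 => if h : j < k then y ⟨j, h⟩ else 0

/-- A tame function of `k` observations: a bounded Borel function on `ℝ^k`. -/
def IsTame {k : ℕ} (F : (Fin k → ℝ) → ℂ) : Prop :=
  Measurable F ∧ ∃ C : ℝ, ∀ y, ‖F y‖ ≤ C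

/-- The signed density `∏ p(1/2^n; x_{j-1} - x_j)` of `(X(1/2^n), …, X(k/2^n))` for the
pseudo-process started from `x_0 = 0`. -/
def density (N n : ℕ) {k : ℕ} (y : Fin k → ℝ) : ℂ :=
  ∏ j : Fin k, kernel N (1 / 2 ^ n) (pathOf y (j : ℕ) - pathOf y ((j : ℕ) + 1))

/-- The pseudo-expectation of a function of the observations at times `1/2^n, …, k/2^n`. -/
def expectation (N n : ℕ) {k : ℕ} (F : (Fin k → ℝ) → ℂ) : ℂ :=
  ∫ y, F y * density N n y

/-- The functional `G` of the sequence `(X(k/2^n))_k` (with `X(0) = 0`) is a function of the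
discrete observations: it is the convergent series of the tame functions `F k` of the first `k`
observations, whose pseudo-expectations are well defined and form an absolutely convergent
series. -/
structure IsDiscreteExpansion (N n : ℕ) (G : (ℕ → ℝ) → ℂ) (F : (k : ℕ) → (Fin k → ℝ) → ℂ) :
    Prop where
  tame : ∀ k, IsTame (F k)
  integrable : ∀ k, Integrable (fun y => F k y * density N n y)
  hasSum : ∀ x : ℕ → ℝ, x 0 = 0 → HasSum (fun k => F k (fun j => x ((j : ℕ) + 1))) (G x)
  summable : Summable fun k => ‖expectation N n (F k)‖

/-- The step process `X_n(t) = x_k` for `t ∈ [k/2^n, (k+1)/2^n)`. -/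
def stepProcess (n : ℕ) (x : ℕ → ℝ) (t : ℝ) : ℝ := x ⌊2 ^ n * t⌋₊

/-- The sojourn time `T_n(t)` of `X_n` in `[0, ∞)` up to time `t`. -/
def sojournTime (n : ℕ) (x : ℕ → ℝ) (t : ℝ) : ℝ :=
  ∫ s in (0 : ℝ)..t, (Set.Ici (0 : ℝ)).indicator (fun _ => (1 : ℝ)) (stepProcess n x s)

/-- The integrand `exp(-λt + iμ X_n(t) - ν T_n(t))`. -/
def integrand (lam : ℂ) (μ ν : ℝ) (n : ℕ) (x : ℕ → ℝ) (t : ℝ) : ℂ :=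
  Complex.exp (-(lam * t) + Complex.I * μ * stepProcess n x t - ν * sojournTime n x t)

/-- The functional `F_n(λ,μ,ν) = ∫_0^∞ exp(-λt + iμ X_n(t) - ν T_n(t)) dt`. -/
def laplaceFunctional (lam : ℂ) (μ ν : ℝ) (n : ℕ) (x : ℕ → ℝ) : ℂ :=
  ∫ t in Set.Ioi (0 : ℝ), integrand lam μ ν n x t

/-- The part of `F_n(λ,μ,ν)` coming from `t ∈ [k/2^n, (k+1)/2^n)`, which is a function of the
`k` observations `X(1/2^n), …, X(k/2^n)`. -/
def slice (lam : ℂ) (μ ν : ℝ) (n k : ℕ) (y : Fin k → ℝ) : ℂ :=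
  ∫ t in ((k : ℝ) / 2 ^ n)..((k + 1 : ℝ) / 2 ^ n), integrand lam μ ν n (pathOf y) t

/-- `E_n(λ,μ,ν)`, the pseudo-expectation of `F_n(λ,μ,ν)` as a function of the discrete
observations. -/
def discreteTransform (N : ℕ) (lam : ℂ) (μ ν : ℝ) (n : ℕ) : ℂ :=
  ∑' k, expectation N n (slice lam μ ν n k)

/-- The roots `θ_j`, `j ∈ J`: the `N`-th roots of `κ_N` with positive real part. -/
def rootsJ (N : ℕ) : Finset ℂ :=
  by classical exact (Polynomial.nthRootsFinset N (kappa N)).filter fun θ => 0 < θ.re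

/-- The roots `θ_k`, `k ∈ K`: the `N`-th roots of `κ_N` with negative real part. -/
def rootsK (N : ℕ) : Finset ℂ :=
  by classical exact (Polynomial.nthRootsFinset N (kappa N)).filter fun θ => θ.re < 0

end PseudoProcess

end

/-!
The pseudo-process observed at the times `k / 2 ^ n` is a random walk whose steps have a signed
density, so its functionals can be treated by fluctuation theory as long as every argument is
algebraic or rests on `∫ |p(t; x)| dx`, which by scaling does not depend on `t`
(`integral_norm_kernel`). A series bounded term by term through this total variation, which exceeds
`1` for `N > 2`, would converge only for large `Re λ`. The absolute convergence for all `Re λ > 0`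
comes instead from Spitzer's identity.

Write `δ = 1 / 2 ^ n`, `w = exp (-ν δ)`, `z = exp (-λ δ)`. The cell `[k δ, (k + 1) δ)` contributes
`z ^ k` times a linear combination of the transforms over `x_k ≥ 0` and `x_k < 0` of the walk in
which each visit of `[0, ∞)` is weighted by `w` (`expectation_slice`). These satisfy a one-step
recursion (`walkTransform_succ`), in which the two half-lines give characteristic functions of
signed measures on `[0, ∞)` and `(-∞, 0)`, two algebras with trivial intersection
(`signedCharFun_disjoint`). The recursion therefore has a single solution with values in these
algebras. The exponentials of the power series with coefficients
`(w ^ k - 1) ψ₊(k δ) / k` and `(1 - w ^ k) ψ₋(k δ) / k`, where `ψ±(t)` is the integral of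
`exp (iμx) p(t; x)` over a half-line, provide a solution (`spitzer_identity`), and `ψ±` being bounded
these series converge in the whole disc `|z| < 1` (`hasSum_expCoeff`).

As `δ → 0` the exponents are Riemann sums of `∫ exp (-λt) (1 - exp (-νt)) / t ψ±(t) dt`. The
derivative in `ν` of this integral is the Laplace transform of `ψ±` at `λ + ν`. It is found by
uniqueness once more: the two Laplace transforms add up to `1 / (s + μ ^ N)`, and so do the
partial fractions of this function with poles at `θ ∈ J` and at `θ ∈ K`, which are transforms of
exponential densities on the two half-lines (`partLaplace_eq`). Integrating in `ν` turns the
exponentials into quotients of products over roots (`exp_spitzerExponent`), and the factorizations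
`∏ (s ^ (1 / N) - iμθ) = s + μ ^ N` for `s = λ` and `s = λ + ν` combine them to the stated limit.
-/

namespace PseudoProcess

open scoped FourierTransform Real

/-! ### The kernel -/

/-- The symbol `exp (-t u ^ N)`, the Fourier transform of the kernel at time `t`. -/
noncomputable def symbol (N : ℕ) (t u : ℝ) : ℂ := (Real.exp (-(t * u ^ N)) : ℂ)

theorem continuous_symbol (N : ℕ) (t : ℝ) : Continuous (symbol N t) := by
  unfold symbol; fun_prop

theorem integrable_pow_mul_symbol {N : ℕ} (hN : 2 ≤ N) (hE : Even N) (m : ℕ) {t : ℝ}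
    (ht : 0 < t) : Integrable fun u : ℝ => (u : ℂ) ^ m * symbol N t u := by
  have hpos : IntegrableOn (fun u : ℝ => u ^ m * Real.exp (-(t * u ^ N))) (Set.Ioi 0) := by
    have h := integrableOn_rpow_mul_exp_neg_mul_rpow (p := N) (s := m) (b := t)
      (by have : (0 : ℝ) ≤ m := m.cast_nonneg
          linarith) (by positivity) ht
    simpa [Real.rpow_natCast] using h
  have hneg : IntegrableOn (fun u : ℝ => u ^ m * Real.exp (-(t * u ^ N))) (Set.Iio 0) := by
    have h := (Measure.measurePreserving_neg (volume : Measure ℝ)).integrableOn_comp_preimage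
      (MeasurableEquiv.neg ℝ).measurableEmbedding (f := fun u : ℝ => u ^ m *
        Real.exp (-(t * u ^ N))) (s := Set.Ioi 0)
    have h' := (h.mpr hpos).const_mul ((-1) ^ m)
    rw [Set.neg_preimage, Set.neg_Ioi, neg_zero] at h'
    refine IntegrableOn.congr_fun h' (fun u _ => ?_) measurableSet_Iio
    simp only [Function.comp, hE.neg_pow, ← mul_assoc, ← mul_pow]
    simp
  have h : Integrable (fun u : ℝ => u ^ m * Real.exp (-(t * u ^ N))) := by
    rw [← integrableOn_univ, ← Set.Iic_union_Ioi (a := (0 : ℝ)), integrableOn_union]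
    exact ⟨(integrableOn_Iic_iff_integrableOn_Iio).mpr hneg, hpos⟩
  simpa [symbol] using h.ofReal (𝕜 := ℂ)

theorem integrable_symbol {N : ℕ} (hN : 2 ≤ N) (hE : Even N) {t : ℝ} (ht : 0 < t) :
    Integrable (symbol N t) := by
  simpa using integrable_pow_mul_symbol hN hE 0 ht

theorem kernel_eq {N : ℕ} (hE : Even N) (t x : ℝ) :
    kernel N t x =
      (1 / (2 * π) : ℂ) * ∫ u : ℝ, Complex.exp (-(Complex.I * u * x)) * symbol N t u := by
  unfold kernel symbol
  congr 2
  ext u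
  rw [mul_right_comm (kappa N), kappa_mul_pow hE]
  push_cast
  congr 2
  ring

theorem kernel_eq_fourier {N : ℕ} (hE : Even N) (t x : ℝ) :
    kernel N t x = (1 / (2 * π) : ℂ) * 𝓕 (symbol N t) (x / (2 * π)) := by
  rw [kernel_eq hE, Real.fourier_real_eq_integral_exp_smul]
  congr 2
  ext u
  rw [smul_eq_mul]
  congr 2
  push_cast
  have : (π : ℂ) ≠ 0 := by exact_mod_cast Real.pi_ne_zero
  field_simp

theorem kernel_neg {N : ℕ} (hE : Even N) (t x : ℝ) : kernel N t (-x) = kernel N t x := by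
  rw [kernel_eq hE, kernel_eq hE, ← integral_neg_eq_self]
  congr 2
  ext u
  simp [symbol, hE.neg_pow]

theorem hasDerivAt_symbol (N : ℕ) (t u : ℝ) :
    HasDerivAt (symbol N t) (-(t * N : ℝ) * ((u : ℂ) ^ (N - 1) * symbol N t u)) u := by
  have h : HasDerivAt (fun u : ℝ => Real.exp (-(t * u ^ N)))
      (Real.exp (-(t * u ^ N)) * (-(t * (N * u ^ (N - 1))))) u :=
    ((((hasDerivAt_pow N u).const_mul t).neg).exp)
  refine h.ofReal_comp.congr_deriv ?_
  simp only [symbol]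
  push_cast
  ring

/-- Two integrable derivatives of the symbol make its Fourier transform `O(1 / (1 + x ^ 2))`. -/
theorem integrable_fourier_symbol {N : ℕ} (hN : 2 ≤ N) (hE : Even N) {t : ℝ} (ht : 0 < t) :
    Integrable (𝓕 (symbol N t)) := by
  set f := symbol N t with hf
  have hint : ∀ m : ℕ, Integrable fun u : ℝ => (u : ℂ) ^ m * f u := fun m =>
    integrable_pow_mul_symbol hN hE m ht
  have hf0 : Integrable f := integrable_symbol hN hE ht
  have hf1 : deriv f = fun u : ℝ => -(t * N : ℝ) * ((u : ℂ) ^ (N - 1) * f u) := by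
    ext u; exact (hasDerivAt_symbol N t u).deriv
  have hd2 : ∀ u : ℝ, HasDerivAt (deriv f) (-(t * N : ℝ) * (((N - 1 : ℕ) : ℂ) *
      ((u : ℂ) ^ (N - 1 - 1) * f u) + -(t * N : ℝ) * ((u : ℂ) ^ (N - 1 + (N - 1)) * f u))) u := by
    intro u
    rw [hf1]
    have h1 : HasDerivAt (fun u : ℝ => (u : ℂ) ^ (N - 1))
        (((N - 1 : ℕ) : ℂ) * (u : ℂ) ^ (N - 1 - 1)) u := by
      simpa using (hasDerivAt_pow (N - 1) (u : ℂ)).comp_ofReal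
    refine ((h1.mul (hasDerivAt_symbol N t u)).const_mul (-(t * N : ℝ) : ℂ)).congr_deriv ?_
    rw [pow_add]
    ring
  have hf2 := funext fun u => (hd2 u).deriv
  have i1 : Integrable (deriv f) := by
    rw [hf1]; exact (hint _).const_mul _
  have i2 : Integrable (deriv (deriv f)) := by
    rw [hf2]
    exact (((hint _).const_mul _).add ((hint _).const_mul _)).const_mul _
  have e1 := Real.fourier_deriv hf0 (fun u => (hasDerivAt_symbol N t u).differentiableAt) i1
  have e2 := Real.fourier_deriv i1 (fun u => (hd2 u).differentiableAt) i2
  have hcont : Continuous (𝓕 f) :=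
    VectorFourier.fourierIntegral_continuous Real.continuous_fourierChar
      (by exact continuous_inner) hf0
  have hb : ∀ (g : ℝ → ℂ) (x : ℝ), ‖𝓕 g x‖ ≤ ∫ u, ‖g u‖ := fun g x =>
    VectorFourier.norm_fourierIntegral_le_integral_norm _ _ _ g x
  set C := (∫ u, ‖f u‖) + ∫ u, ‖deriv (deriv f) u‖ with hC
  refine (integrable_inv_one_add_sq.const_mul C).mono' hcont.aestronglyMeasurable
    (Eventually.of_forall fun x => ?_)
  have h1 := hb f x
  have h2 := hb (deriv (deriv f)) x
  rw [e2, e1] at h2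
  simp only [smul_smul, norm_smul, norm_mul, Complex.norm_ofNat, Complex.norm_real,
    Complex.norm_I, Real.norm_eq_abs, abs_of_pos Real.pi_pos, mul_one] at h2
  have hp : (1 : ℝ) ≤ (2 * π) * (2 * π) := by nlinarith [Real.pi_gt_three]
  have hx : 0 ≤ x ^ 2 * ‖𝓕 f x‖ := by positivity
  have h3 : x ^ 2 * ‖𝓕 f x‖ ≤ ∫ u, ‖deriv (deriv f) u‖ := by
    refine le_trans ?_ h2
    have : 2 * π * |x| * (2 * π * |x|) * ‖𝓕 f x‖
        = (2 * π) * (2 * π) * (x ^ 2 * ‖𝓕 f x‖) := by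
      rw [← sq_abs x]; ring
    rw [this]
    nlinarith
  rw [← div_eq_mul_inv, le_div_iff₀ (by positivity)]
  nlinarith

theorem continuous_kernel {N : ℕ} (hN : 2 ≤ N) (hE : Even N) {t : ℝ} (ht : 0 < t) :
    Continuous (kernel N t) := by
  have h : Continuous (𝓕 (symbol N t)) :=
    VectorFourier.fourierIntegral_continuous Real.continuous_fourierChar
      (by exact continuous_inner) (integrable_symbol hN hE ht)
  rw [funext (kernel_eq_fourier hE t)]
  fun_prop

theorem integrable_kernel {N : ℕ} (hN : 2 ≤ N) (hE : Even N) {t : ℝ} (ht : 0 < t) :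
    Integrable (kernel N t) := by
  rw [funext (kernel_eq_fourier hE t)]
  exact ((integrable_fourier_symbol hN hE ht).comp_div (by positivity)).const_mul _

/-- Fourier inversion: the kernel has the Fourier transform `exp (-t μ ^ N)`. -/
theorem integral_exp_mul_kernel {N : ℕ} (hN : 2 ≤ N) (hE : Even N) {t : ℝ} (ht : 0 < t) (μ : ℝ) :
    ∫ x : ℝ, Complex.exp (Complex.I * μ * x) * kernel N t x = symbol N t μ := by
  have hinv := congrFun ((continuous_symbol N t).fourierInv_fourier_eq
    (integrable_symbol hN hE ht) (integrable_fourier_symbol hN hE ht)) μ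
  rw [Real.fourierInv_eq'] at hinv
  rw [← hinv]
  have hsub := Measure.integral_comp_div
    (fun v : ℝ => Complex.exp (↑(2 * π * inner ℝ v μ) * Complex.I) • 𝓕 (symbol N t) v) (2 * π)
  rw [abs_of_pos (by positivity)] at hsub
  have hpi : (π : ℂ) ≠ 0 := by exact_mod_cast Real.pi_ne_zero
  have h2 : (∫ v : ℝ, Complex.exp (↑(2 * π * inner ℝ v μ) * Complex.I) • 𝓕 (symbol N t) v)
      = (1 / (2 * π) : ℂ) * ((2 * π : ℝ) • ∫ v : ℝ,
        Complex.exp (↑(2 * π * inner ℝ v μ) * Complex.I) • 𝓕 (symbol N t) v) := by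
    rw [Complex.real_smul, ← mul_assoc, Complex.ofReal_mul, Complex.ofReal_ofNat,
      one_div_mul_cancel (by simp [hpi]), one_mul]
  rw [h2, ← hsub, ← integral_const_mul]
  congr 1
  ext x
  rw [kernel_eq_fourier hE, smul_eq_mul]
  have : Complex.exp (Complex.I * μ * x)
      = Complex.exp (↑(2 * π * inner ℝ (x / (2 * π)) μ) * Complex.I) := by
    congr 1
    simp only [RCLike.inner_apply, conj_trivial]
    push_cast
    field_simp
  rw [this]
  ring

/-- Scaling: the kernel at time `t = s ^ N` is a rescaled copy of the kernel at time `1`. -/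
theorem kernel_scaling {N : ℕ} (hE : Even N) {s : ℝ} (hs : 0 < s) (x : ℝ) :
    kernel N (s ^ N) (s * x) = (s⁻¹ : ℝ) * kernel N 1 x := by
  rw [kernel_eq hE, kernel_eq hE]
  have h := Measure.integral_comp_mul_left
    (fun u : ℝ => Complex.exp (-(Complex.I * u * x)) * symbol N 1 u) s
  rw [abs_of_pos (inv_pos.mpr hs), Complex.real_smul] at h
  rw [mul_left_comm, ← h]
  congr 2
  ext u
  simp only [symbol, mul_pow, one_mul]
  congr 2
  push_cast
  ring

/-! ### Exponentials of power series -/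

section ExpCoeff

open Finset PowerSeries

variable {R : Type*} [CommRing R] [Algebra ℝ R]

/-- The coefficients of the formal power series `exp (∑ k, a k * X ^ (k + 1) / (k + 1))`. They are
defined by the recursion that expresses that this series `P` satisfies `P' = (∑ k, a k * X ^ k) P`
and has constant coefficient `1`. -/
noncomputable def expCoeff (a : ℕ → R) : ℕ → R
  | 0 => 1
  | n + 1 => ((n : ℝ) + 1)⁻¹ • ∑ i : Fin (n + 1), a i * expCoeff a (n - i)

@[simp]
theorem expCoeff_zero (a : ℕ → R) : expCoeff a 0 = 1 := by
  rw [expCoeff]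

theorem expCoeff_succ (a : ℕ → R) (n : ℕ) :
    expCoeff a (n + 1) =
      ((n : ℝ) + 1)⁻¹ • ∑ ij ∈ antidiagonal n, a ij.1 * expCoeff a ij.2 := by
  rw [expCoeff, Nat.sum_antidiagonal_eq_sum_range_succ (fun i j => a i * expCoeff a j),
    ← Fin.sum_univ_eq_sum_range (fun i => a i * expCoeff a (n - i))]

theorem eq_expCoeff {a p : ℕ → R} (h0 : p 0 = 1)
    (h : ∀ n, p (n + 1) * ((n : R) + 1) = ∑ ij ∈ antidiagonal n, a ij.1 * p ij.2) (n : ℕ) :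
    p n = expCoeff a n := by
  induction n using Nat.strong_induction_on with
  | _ n ih =>
    cases n with
    | zero => simp [h0]
    | succ n =>
      have hs : ∑ ij ∈ antidiagonal n, a ij.1 * expCoeff a ij.2 = p (n + 1) * ((n : R) + 1) := by
        rw [h]
        refine sum_congr rfl fun ij hij => ?_
        rw [ih ij.2 (by have := mem_antidiagonal.mp hij; omega)]
      have hn : (n : ℝ) + 1 ≠ 0 := by positivity
      have hc : (n : R) + 1 = algebraMap ℝ R (n + 1) := by simp
      rw [expCoeff_succ, hs, hc, mul_comm, ← Algebra.smul_def, smul_smul, inv_mul_cancel₀ hn,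
        one_smul]

theorem expCoeff_succ_mul (a : ℕ → R) (n : ℕ) :
    expCoeff a (n + 1) * ((n : R) + 1) = ∑ ij ∈ antidiagonal n, a ij.1 * expCoeff a ij.2 := by
  have hn : (n : ℝ) + 1 ≠ 0 := by positivity
  have hc : (n : R) + 1 = algebraMap ℝ R (n + 1) := by simp
  rw [expCoeff_succ, hc, mul_comm, ← Algebra.smul_def, smul_smul, mul_inv_cancel₀ hn, one_smul]

theorem derivative_mk_expCoeff (a : ℕ → R) :
    derivative R (PowerSeries.mk (expCoeff a)) = PowerSeries.mk a * PowerSeries.mk (expCoeff a) := by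
  ext n
  rw [coeff_derivative, coeff_mul, coeff_mk, expCoeff_succ_mul]
  simp

theorem eq_mk_expCoeff {a : ℕ → R} {P : R⟦X⟧} (h0 : coeff 0 P = 1)
    (h : derivative R P = PowerSeries.mk a * P) : P = PowerSeries.mk (expCoeff a) := by
  ext n
  rw [coeff_mk]
  refine eq_expCoeff (p := fun n => coeff n P) h0 (fun n => ?_) n
  rw [← coeff_derivative, h, coeff_mul]
  simp

theorem mk_expCoeff_add (a b : ℕ → R) :
    PowerSeries.mk (expCoeff fun k => a k + b k) = PowerSeries.mk (expCoeff a) * PowerSeries.mk (expCoeff b) := by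
  refine (eq_mk_expCoeff ?_ ?_).symm
  · simp [coeff_mul]
  · have : PowerSeries.mk (fun k => a k + b k) = PowerSeries.mk a + PowerSeries.mk b := by ext; simp
    rw [Derivation.leibniz, derivative_mk_expCoeff, derivative_mk_expCoeff, this, smul_eq_mul,
      smul_eq_mul]
    ring

/-- The exponential of `∑ k, (c X) ^ (k + 1) / (k + 1) = -log (1 - c X)` is the geometric series. -/
theorem expCoeff_pow_succ (c : R) (n : ℕ) : expCoeff (fun k => c ^ (k + 1)) n = c ^ n := by
  refine (eq_expCoeff (p := fun n => c ^ n) (pow_zero c) (fun n => ?_) n).symm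
  rw [sum_congr rfl (g := fun _ => c ^ (n + 1))]
  · simp [mul_comm]
  · intro ij hij
    rw [← pow_add, ← mem_antidiagonal.mp hij]
    congr 1
    ring

theorem one_sub_mul_mk_expCoeff_pow (c : R) :
    (1 - X * C c) * PowerSeries.mk (expCoeff fun k => c ^ (k + 1)) = 1 := by
  ext n
  cases n with
  | zero => simp [sub_mul, mul_assoc]
  | succ n =>
    rw [sub_mul, one_mul, mul_assoc, map_sub, coeff_succ_X_mul, coeff_C_mul]
    simp only [coeff_mk, expCoeff_pow_succ, coeff_one]
    simp [pow_succ']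

theorem expCoeff_succ_mem (A : NonUnitalSubalgebra ℝ R) {a : ℕ → R} (ha : ∀ k, a k ∈ A) (n : ℕ) :
    expCoeff a (n + 1) ∈ A := by
  induction n using Nat.strong_induction_on with
  | _ n ih =>
    rw [expCoeff_succ]
    refine A.smul_mem _ (sum_mem fun ij hij => ?_)
    obtain ⟨i, j⟩ := ij
    cases j with
    | zero => simpa using ha i
    | succ j =>
      exact A.mul_mem (ha _) (ih j (by have := mem_antidiagonal.mp hij; simp only at this; omega))

/-- Spitzer's identity in the form of Baxter and Kingman. Two sequences `u`, `v` in complementary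
non-unital subalgebras satisfying the recursion of a random walk with step `φ`, in which each visit
of the `u`-side is weighted by `w`, are coefficients of exponentials of the
projections `a k`, `b k` of the powers `φ ^ (k + 1)`. -/
theorem spitzer_identity (Ap Am : NonUnitalSubalgebra ℝ R)
    (hdisj : ∀ x ∈ Ap, x ∈ Am → x = 0) {φ : R} {w : ℝ} (hw0 : w ≠ 0) (hw1 : w ≠ 1)
    {a b u v : ℕ → R} (ha : ∀ k, a k ∈ Ap) (hb : ∀ k, b k ∈ Am)
    (hab : ∀ k, a k + b k = φ ^ (k + 1)) (hu : ∀ k, u (k + 1) ∈ Ap) (hv : ∀ k, v (k + 1) ∈ Am)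
    (h0 : u 0 + v 0 = 1) (hrec : ∀ k, w⁻¹ • u (k + 1) + v (k + 1) = φ * (u k + v k)) (k : ℕ) :
    (1 - w⁻¹) • u (k + 1) = expCoeff (fun j => (w ^ (j + 1) - 1) • a j) (k + 1) ∧
      (1 - w) • v (k + 1) = expCoeff (fun j => (1 - w ^ (j + 1)) • b j) (k + 1) := by
  set a' : ℕ → R := fun j => (w ^ (j + 1) - 1) • a j with ha'
  set b' : ℕ → R := fun j => (1 - w ^ (j + 1)) • b j with hb'
  have hw1' : 1 - w ≠ 0 := sub_ne_zero.mpr hw1.symm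
  have hwi : 1 - w⁻¹ ≠ 0 := sub_ne_zero.mpr (by simpa [eq_comm] using hw1)
  -- `exp b' * (1 - φ X) = exp a' * (1 - w φ X)`, from `b' k + (w φ) ^ (k + 1) = a' k + φ ^ (k + 1)`
  have hfac : PowerSeries.mk (expCoeff b') * (1 - X * C φ) = PowerSeries.mk (expCoeff a') * (1 - X * C (w • φ)) := by
    have hsum : (fun k => b' k + (w • φ) ^ (k + 1)) = fun k => a' k + φ ^ (k + 1) := by
      ext k
      simp only [ha', hb', smul_pow, ← hab, smul_add, sub_smul, one_smul]
      abel
    have h1 := mk_expCoeff_add b' fun k => (w • φ) ^ (k + 1)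
    have h2 := mk_expCoeff_add a' fun k => φ ^ (k + 1)
    rw [hsum, h2] at h1
    have g1 := one_sub_mul_mk_expCoeff_pow φ
    have g2 := one_sub_mul_mk_expCoeff_pow (w • φ)
    linear_combination (PowerSeries.mk (expCoeff a') * (1 - X * C (w • φ))) * g1
      - (PowerSeries.mk (expCoeff b') * (1 - X * C φ)) * g2
      - (1 - X * C φ) * (1 - X * C (w • φ)) * h1
  have hcoef : ∀ k, expCoeff b' (k + 1) - φ * expCoeff b' k
      = expCoeff a' (k + 1) - w • φ * expCoeff a' k := by
    intro k
    have := congrArg (coeff (k + 1)) hfac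
    simp only [mul_sub, mul_one, map_sub, coeff_mk] at this
    rw [mul_left_comm, coeff_succ_X_mul, coeff_mul_C, mul_left_comm, coeff_succ_X_mul,
      coeff_mul_C, coeff_mk, coeff_mk] at this
    rw [mul_comm φ, mul_comm (w • φ), this]
  -- the partial recursion determines the next pair from the sum of the present one
  have step : ∀ k, (1 - w) • (u k + v k) = expCoeff b' k - w • expCoeff a' k →
      (1 - w⁻¹) • u (k + 1) = expCoeff a' (k + 1) ∧
        (1 - w) • v (k + 1) = expCoeff b' (k + 1) := by
    intro k hk
    have e1 : (1 - w) • (w⁻¹ • u (k + 1) + v (k + 1))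
        = expCoeff b' (k + 1) - expCoeff a' (k + 1) := by
      rw [hrec, ← mul_smul_comm, hk, mul_sub]
      have := hcoef k
      rw [smul_mul_assoc, ← mul_smul_comm] at this
      linear_combination -this
    have e2 : (1 - w⁻¹) • u (k + 1) - expCoeff a' (k + 1)
        = (1 - w) • v (k + 1) - expCoeff b' (k + 1) := by
      have : (1 - w) • w⁻¹ • u (k + 1) = -((1 - w⁻¹) • u (k + 1)) := by
        rw [smul_smul, ← neg_smul]
        congr 1
        field_simp
        ring
      rw [smul_add, this] at e1
      linear_combination -e1
    have m1 : (1 - w⁻¹) • u (k + 1) - expCoeff a' (k + 1) ∈ Ap :=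
      sub_mem (Ap.smul_mem _ (hu k)) (expCoeff_succ_mem Ap (fun j => Ap.smul_mem _ (ha j)) k)
    have m2 : (1 - w) • v (k + 1) - expCoeff b' (k + 1) ∈ Am :=
      sub_mem (Am.smul_mem _ (hv k)) (expCoeff_succ_mem Am (fun j => Am.smul_mem _ (hb j)) k)
    have z := hdisj _ m1 (e2 ▸ m2)
    exact ⟨sub_eq_zero.mp z, sub_eq_zero.mp (e2 ▸ z)⟩
  have main : ∀ k, (1 - w) • (u k + v k) = expCoeff b' k - w • expCoeff a' k := by
    intro k
    induction k with
    | zero => rw [h0, expCoeff_zero, expCoeff_zero, sub_smul, one_smul]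
    | succ k ih =>
      obtain ⟨e1, e2⟩ := step k ih
      rw [← e1, ← e2, smul_add, smul_smul]
      have : w * (1 - w⁻¹) = -(1 - w) := by field_simp; ring
      rw [this, neg_smul]
      abel
  exact step k (main k)

end ExpCoeff

theorem expCoeff_apply (a : ℕ → ℝ → ℂ) (n : ℕ) (μ : ℝ) :
    expCoeff a n μ = expCoeff (fun j => a j μ) n := by
  refine eq_expCoeff (p := fun n => expCoeff a n μ) (by simp) (fun n => ?_) n
  have := congrFun (expCoeff_succ_mul a n) μ
  simpa using this

theorem eq_of_hasSum_pow {a b : ℕ → ℂ} {f : ℂ → ℂ}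
    (ha : ∀ z : ℂ, ‖z‖ < 1 → HasSum (fun n => a n * z ^ n) (f z))
    (hb : ∀ z : ℂ, ‖z‖ < 1 → HasSum (fun n => b n * z ^ n) (f z)) : a = b := by
  have key : ∀ c : ℕ → ℂ, (∀ z : ℂ, ‖z‖ < 1 → HasSum (fun n => c n * z ^ n) (f z)) →
      HasFPowerSeriesAt f (FormalMultilinearSeries.ofScalars ℂ c) 0 := by
    intro c hc
    rw [hasFPowerSeriesAt_iff]
    filter_upwards [Metric.ball_mem_nhds (0 : ℂ) one_pos] with z hz
    simpa [FormalMultilinearSeries.coeff_ofScalars, mul_comm] using hc z (by simpa using hz)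
  have h := (key a ha).eq_formalMultilinearSeries (key b hb)
  ext n
  simpa [FormalMultilinearSeries.coeff_ofScalars] using
    congrArg (fun p : FormalMultilinearSeries ℂ ℂ ℂ => p.coeff n) h

theorem hasSum_taylor {f : ℂ → ℂ} (hf : DifferentiableOn ℂ f (Metric.ball 0 1)) {z : ℂ}
    (hz : ‖z‖ < 1) :
    HasSum (fun n : ℕ => ((n.factorial : ℂ)⁻¹ * iteratedDeriv n f 0) * z ^ n) (f z) := by
  have := Complex.hasSum_taylorSeries_on_ball hf (z := z) (by simpa using hz)
  refine Eq.mpr (congrArg (fun g => HasSum g (f z)) (funext fun n => ?_)) this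
  simp only [smul_eq_mul, sub_zero]
  ring

/-- The power series with coefficients `expCoeff a`, for bounded `a`, converges in the unit disc
to the exponential of `∑ k, a k * z ^ (k + 1) / (k + 1)`. -/
theorem hasSum_expCoeff {a : ℕ → ℂ} {C : ℝ} (ha : ∀ k, ‖a k‖ ≤ C) {z : ℂ} (hz : ‖z‖ < 1) :
    HasSum (fun n => expCoeff a n * z ^ n)
      (Complex.exp (∑' k : ℕ, a k * z ^ (k + 1) / (k + 1))) := by
  set B : ℂ → ℂ := fun z => ∑' k : ℕ, a k * z ^ k with hB
  set A : ℂ → ℂ := fun z => ∑' k : ℕ, a k * z ^ (k + 1) / (k + 1) with hA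
  have hC : 0 ≤ C := (norm_nonneg _).trans (ha 0)
  have hBs : ∀ z : ℂ, ‖z‖ < 1 → Summable fun k => ‖a k * z ^ k‖ := by
    intro z hz
    refine Summable.of_nonneg_of_le (fun _ => norm_nonneg _) (fun k => ?_)
      ((summable_geometric_of_lt_one (norm_nonneg z) hz).mul_left C)
    rw [norm_mul, norm_pow]
    exact mul_le_mul_of_nonneg_right (ha k) (by positivity)
  have hAd : ∀ z : ℂ, ‖z‖ < 1 → HasDerivAt A (B z) z := by
    intro z hz
    obtain ⟨r, hzr, hr⟩ := exists_between hz
    have hr0 : 0 ≤ r := (norm_nonneg z).trans hzr.le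
    refine hasDerivAt_tsum_of_isPreconnected (𝕜 := ℂ) (F := ℂ)
      (g := fun (k : ℕ) (z : ℂ) => a k * z ^ (k + 1) / (k + 1)) (g' := fun k z => a k * z ^ k) (t := Metric.ball (0 : ℂ) r) (y₀ := 0)
      (u := fun k => C * r ^ k) ((summable_geometric_of_lt_one hr0 hr).mul_left C)
      Metric.isOpen_ball (convex_ball _ _).isPreconnected (fun k y _ => ?_) (fun k y hy => ?_)
      (by simpa using (norm_nonneg z).trans_lt hzr) ?_ (by simpa using hzr)
    · have h := ((hasDerivAt_pow (k + 1) y).const_mul (a k)).div_const ((k : ℂ) + 1)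
      refine h.congr_deriv ?_
      have : (k : ℂ) + 1 ≠ 0 := by exact_mod_cast k.succ_ne_zero
      push_cast
      field_simp
    · rw [norm_mul, norm_pow]
      have : ‖y‖ ≤ r := by simpa using (Metric.mem_ball.mp hy).le
      gcongr
      exact ha k
    · simp
  have hd : ∀ z : ℂ, ‖z‖ < 1 → HasDerivAt (fun z => Complex.exp (A z))
      (Complex.exp (A z) * B z) z := fun z hz => (hAd z hz).cexp
  have hdo : DifferentiableOn ℂ (fun z => Complex.exp (A z)) (Metric.ball 0 1) :=
    fun z hz => (hd z (by simpa using hz)).differentiableAt.differentiableWithinAt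
  have hT := fun (z : ℂ) (hz : ‖z‖ < 1) => hasSum_taylor hdo hz
  have hT' := fun (z : ℂ) (hz : ‖z‖ < 1) =>
    hasSum_taylor (f := deriv fun z => Complex.exp (A z)) (hdo.deriv Metric.isOpen_ball) hz
  have hcauchy : ∀ z : ℂ, ‖z‖ < 1 → HasSum (fun n => (∑ ij ∈ Finset.HasAntidiagonal.antidiagonal n, a ij.1 *
      ((ij.2.factorial : ℂ)⁻¹ * iteratedDeriv ij.2 (fun z => Complex.exp (A z)) 0)) * z ^ n)
      (deriv (fun z => Complex.exp (A z)) z) := by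
    intro z hz
    have h2 := (hT z hz).summable.norm
    have h := summable_norm_sum_mul_antidiagonal_of_summable_norm (hBs z hz) h2
    have e := tsum_mul_tsum_eq_tsum_sum_antidiagonal_of_summable_norm (hBs z hz) h2
    have hs := h.of_norm.hasSum
    rw [← e, (hT z hz).tsum_eq] at hs
    rw [(hd z hz).deriv, mul_comm]
    refine Eq.mpr (congrArg (fun g => HasSum g _) (funext fun n => ?_)) hs
    rw [Finset.sum_mul]
    refine Finset.sum_congr rfl fun ij hij => ?_
    rw [← Finset.HasAntidiagonal.mem_antidiagonal.mp hij, pow_add]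
    ring
  -- comparing the two expansions of `(exp A)' = B exp A` gives the recursion of `expCoeff`
  have hrec := congrFun (eq_of_hasSum_pow hT' hcauchy)
  have heq := eq_expCoeff (a := a)
    (p := fun n => (n.factorial : ℂ)⁻¹ * iteratedDeriv n (fun z => Complex.exp (A z)) 0)
    (by simp [hA]) (fun n => by
      rw [← hrec n, ← iteratedDeriv_succ', Nat.factorial_succ]
      have h1 : (n.factorial : ℂ) ≠ 0 := by exact_mod_cast n.factorial_ne_zero
      have h2 : (n : ℂ) + 1 ≠ 0 := by exact_mod_cast n.succ_ne_zero
      push_cast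
      field_simp)
  simp_rw [← heq]
  exact hT z hz

/-! ### Characteristic functions of signed measures -/

theorem integrable_exp_mul_I (m : Measure ℝ) [IsFiniteMeasure m] (t : ℝ) :
    Integrable (fun x : ℝ => Complex.exp (t * x * Complex.I)) m := by
  refine (integrable_const (1 : ℝ)).mono' (by fun_prop) (Eventually.of_forall fun x => ?_)
  rw [← Complex.ofReal_mul, Complex.norm_exp_ofReal_mul_I]

theorem charFun_add_measure (m n : Measure ℝ) [IsFiniteMeasure m] [IsFiniteMeasure n] :
    charFun (m + n) = charFun m + charFun n := by
  ext t
  simp only [Pi.add_apply, charFun_apply_real]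
  exact integral_add_measure (integrable_exp_mul_I m t) (integrable_exp_mul_I n t)

theorem charFun_smul_measure (m : Measure ℝ) (c : ENNReal) :
    charFun (c • m) = c.toReal • charFun m := by
  ext t
  simp only [Pi.smul_apply, charFun_apply_real, integral_smul_measure]

theorem ae_conv_mem {S : Set ℝ} (hS : MeasurableSet S)
    (hadd : ∀ x ∈ S, ∀ y ∈ S, x + y ∈ S) {m n : Measure ℝ} [IsFiniteMeasure m]
    [IsFiniteMeasure n] (hm : ∀ᵐ x ∂m, x ∈ S) (hn : ∀ᵐ x ∂n, x ∈ S) :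
    ∀ᵐ x ∂(m.conv n), x ∈ S := by
  refine (ae_map_iff (p := fun x => x ∈ S) (by fun_prop) hS).mpr ?_
  have h1 : ∀ᵐ p ∂m.prod n, p.1 ∈ S := Measure.quasiMeasurePreserving_fst.ae hm
  have h2 : ∀ᵐ p ∂m.prod n, p.2 ∈ S := Measure.quasiMeasurePreserving_snd.ae hn
  filter_upwards [h1, h2] with p hp1 hp2 using hadd _ hp1 _ hp2

/-- The characteristic functions of the finite signed measures carried by a set `S` closed under
addition, as an algebra under pointwise operations. The signed measure is encoded as a difference
of two finite measures. -/
noncomputable def signedCharFun (S : Set ℝ) (hS : MeasurableSet S)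
    (hadd : ∀ x ∈ S, ∀ y ∈ S, x + y ∈ S) : NonUnitalSubalgebra ℝ (ℝ → ℂ) where
  carrier := {f | ∃ m₁ m₂ : Measure ℝ, IsFiniteMeasure m₁ ∧ IsFiniteMeasure m₂ ∧
    (∀ᵐ x ∂m₁, x ∈ S) ∧ (∀ᵐ x ∂m₂, x ∈ S) ∧ f = charFun m₁ - charFun m₂}
  add_mem' := by
    rintro _ _ ⟨m₁, m₂, _, _, h₁, h₂, rfl⟩ ⟨n₁, n₂, _, _, k₁, k₂, rfl⟩
    refine ⟨m₁ + n₁, m₂ + n₂, inferInstance, inferInstance, ?_, ?_, ?_⟩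
    · exact ae_add_measure_iff.mpr ⟨h₁, k₁⟩
    · exact ae_add_measure_iff.mpr ⟨h₂, k₂⟩
    · rw [charFun_add_measure, charFun_add_measure]
      abel
  zero_mem' := ⟨0, 0, inferInstance, inferInstance, by simp, by simp, by ext; simp⟩
  smul_mem' := by
    rintro c _ ⟨m₁, m₂, _, _, h₁, h₂, rfl⟩
    rcases le_total 0 c with hc | hc
    · refine ⟨ENNReal.ofReal c • m₁, ENNReal.ofReal c • m₂,
        m₁.smul_finite ENNReal.ofReal_ne_top, m₂.smul_finite ENNReal.ofReal_ne_top,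
        Measure.ae_smul_measure h₁ _, Measure.ae_smul_measure h₂ _, ?_⟩
      rw [charFun_smul_measure, charFun_smul_measure, ENNReal.toReal_ofReal hc, smul_sub]
    · refine ⟨ENNReal.ofReal (-c) • m₂, ENNReal.ofReal (-c) • m₁,
        m₂.smul_finite ENNReal.ofReal_ne_top, m₁.smul_finite ENNReal.ofReal_ne_top,
        Measure.ae_smul_measure h₂ _, Measure.ae_smul_measure h₁ _, ?_⟩
      rw [charFun_smul_measure, charFun_smul_measure, ENNReal.toReal_ofReal (by linarith),
        smul_sub, neg_smul, neg_smul]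
      abel
  mul_mem' := by
    rintro _ _ ⟨m₁, m₂, _, _, h₁, h₂, rfl⟩ ⟨n₁, n₂, _, _, k₁, k₂, rfl⟩
    refine ⟨m₁.conv n₁ + m₂.conv n₂, m₁.conv n₂ + m₂.conv n₁, inferInstance, inferInstance,
      ?_, ?_, ?_⟩
    · exact ae_add_measure_iff.mpr ⟨ae_conv_mem hS hadd h₁ k₁, ae_conv_mem hS hadd h₂ k₂⟩
    · exact ae_add_measure_iff.mpr ⟨ae_conv_mem hS hadd h₁ k₂, ae_conv_mem hS hadd h₂ k₁⟩
    · rw [charFun_add_measure, charFun_add_measure]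
      ext t
      simp only [Pi.mul_apply, Pi.sub_apply, Pi.add_apply, charFun_conv]
      ring

/-- By uniqueness of characteristic functions, signed measures carried by disjoint sets have the
same characteristic function only if both vanish. -/
theorem signedCharFun_disjoint {S T : Set ℝ} {hS : MeasurableSet S} {hT : MeasurableSet T}
    {hSa : ∀ x ∈ S, ∀ y ∈ S, x + y ∈ S} {hTa : ∀ x ∈ T, ∀ y ∈ T, x + y ∈ T}
    (hST : Disjoint S T) (f : ℝ → ℂ) (hf : f ∈ signedCharFun S hS hSa)
    (hf' : f ∈ signedCharFun T hT hTa) : f = 0 := by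
  obtain ⟨m₁, m₂, _, _, h₁, h₂, rfl⟩ := hf
  obtain ⟨n₁, n₂, _, _, k₁, k₂, h⟩ := hf'
  have e : m₁ + n₂ = m₂ + n₁ := by
    refine Measure.ext_of_charFun ?_
    rw [charFun_add_measure, charFun_add_measure]
    linear_combination h
  have r : ∀ n : Measure ℝ, (∀ᵐ x ∂n, x ∈ T) → n.restrict S = 0 := by
    intro n hn
    rw [Measure.restrict_eq_zero]
    refine measure_mono_null (fun x hx => ?_) (ae_iff.mp hn)
    exact fun hxT => Set.disjoint_left.mp hST hx hxT
  have e' := congrArg (fun m : Measure ℝ => m.restrict S) e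
  simp only [Measure.restrict_add, r _ k₁, r _ k₂, add_zero,
    Measure.restrict_eq_self_of_ae_mem h₁, Measure.restrict_eq_self_of_ae_mem h₂] at e'
  rw [e', sub_self]

/-- A signed density carried by the event `X ∈ S` has the transform of a signed measure
carried by `S`. -/
theorem integral_exp_mem_signedCharFun {S : Set ℝ} {hS : MeasurableSet S}
    {hadd : ∀ x ∈ S, ∀ y ∈ S, x + y ∈ S} {Ω : Type*} [MeasurableSpace Ω] {P : Measure Ω}
    {g : Ω → ℝ} (hg : Measurable g) (hgi : Integrable g P) {X : Ω → ℝ} (hX : Measurable X)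
    (hsupp : ∀ ω, g ω ≠ 0 → X ω ∈ S) :
    (fun μ : ℝ => ∫ ω, Complex.exp (Complex.I * μ * X ω) * g ω ∂P) ∈
      signedCharFun S hS hadd := by
  have key : ∀ h : Ω → ℝ, Measurable h → Integrable h P → (∀ ω, 0 < h ω → X ω ∈ S) →
      IsFiniteMeasure ((P.withDensity fun ω => ENNReal.ofReal (h ω)).map X) ∧
      (∀ᵐ x ∂((P.withDensity fun ω => ENNReal.ofReal (h ω)).map X), x ∈ S) ∧
      ∀ μ : ℝ, charFun ((P.withDensity fun ω => ENNReal.ofReal (h ω)).map X) μ =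
        ∫ ω, ((max (h ω) 0 : ℝ) : ℂ) * Complex.exp (Complex.I * μ * X ω) ∂P := by
    intro h hh hi hs
    have := isFiniteMeasure_withDensity_ofReal hi.2
    refine ⟨Measure.isFiniteMeasure_map _ X, ?_, fun μ => ?_⟩
    · refine (ae_map_iff (p := fun x => x ∈ S) hX.aemeasurable hS).mpr ?_
      rw [ae_withDensity_iff (by fun_prop)]
      refine Eventually.of_forall fun ω hω => hs ω ?_
      simpa using hω
    · rw [charFun_apply_real, integral_map hX.aemeasurable (by fun_prop),
        integral_withDensity_eq_integral_toReal_smul (by fun_prop)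
          (Eventually.of_forall fun _ => ENNReal.ofReal_lt_top)]
      congr 1
      ext ω
      rw [ENNReal.toReal_ofReal', Complex.real_smul]
      congr 2
      ring
  obtain ⟨f₁, s₁, c₁⟩ := key g hg hgi fun ω hω => hsupp ω hω.ne'
  obtain ⟨f₂, s₂, c₂⟩ := key (-g) hg.neg hgi.neg fun ω hω =>
    hsupp ω fun h0 => by simp [h0] at hω
  refine ⟨_, _, f₁, f₂, s₁, s₂, ?_⟩
  ext μ
  have hint : ∀ h : Ω → ℝ, Measurable h → Integrable h P →
      Integrable (fun ω => ((max (h ω) 0 : ℝ) : ℂ) * Complex.exp (Complex.I * μ * X ω)) P := by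
    intro h hh hi
    refine hi.norm.mono' (by fun_prop) (Eventually.of_forall fun ω => ?_)
    rw [norm_mul, mul_assoc, mul_comm Complex.I, ← Complex.ofReal_mul,
      Complex.norm_exp_ofReal_mul_I, mul_one, Complex.norm_real, Real.norm_eq_abs,
      Real.norm_eq_abs]
    rcases le_total (h ω) 0 with h0 | h0 <;> simp [h0]
  rw [Pi.sub_apply, c₁, c₂, ← integral_sub (hint g hg hgi) (hint _ hg.neg hgi.neg)]
  congr 1
  ext ω
  rw [← sub_mul, ← Complex.ofReal_sub, mul_comm]
  congr 2
  simp only [Pi.neg_apply]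
  rcases le_total (g ω) 0 with h0 | h0 <;> simp [h0]

/-! ### The step process and its sojourn time -/

/-- The weight of a visit at `x`: the factor `w` if `x` lies in `[0, ∞)`. -/
noncomputable def visitWeight (w x : ℝ) : ℝ := if 0 ≤ x then w else 1

theorem measurable_visitWeight (w : ℝ) : Measurable (visitWeight w) :=
  Measurable.ite measurableSet_Ici measurable_const measurable_const

theorem visitWeight_pos {w : ℝ} (hw : 0 < w) (x : ℝ) : 0 < visitWeight w x := by
  unfold visitWeight; split_ifs <;> linarith

theorem visitWeight_le_one {w : ℝ} (hw : w ≤ 1) (x : ℝ) : visitWeight w x ≤ 1 := by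
  unfold visitWeight; split_ifs <;> linarith

/-- The contribution of one time step to the Laplace functional when the process sits at `x`. -/
noncomputable def holdingFactor (lam : ℂ) (ν : ℝ) (n : ℕ) (x : ℝ) : ℂ :=
  ∫ s in (0 : ℝ)..(1 / 2 ^ n), Complex.exp (-((lam + if 0 ≤ x then (ν : ℂ) else 0) * s))

theorem measurable_stepProcess (n : ℕ) (x : ℕ → ℝ) : Measurable (stepProcess n x) :=
  (measurable_from_nat (f := x)).comp
    (Nat.measurable_floor.comp (measurable_const.mul measurable_id))

theorem stepProcess_eq (n : ℕ) (x : ℕ → ℝ) (k : ℕ) {t : ℝ} (h1 : (k : ℝ) / 2 ^ n ≤ t)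
    (h2 : t < ((k : ℝ) + 1) / 2 ^ n) : stepProcess n x t = x k := by
  have h2n : (0 : ℝ) < 2 ^ n := by positivity
  unfold stepProcess
  congr 1
  have ht : 0 ≤ t := le_trans (by positivity) h1
  rw [Nat.floor_eq_iff (by positivity)]
  rw [div_le_iff₀ h2n] at h1
  rw [lt_div_iff₀ h2n] at h2
  constructor <;> linarith

theorem measurable_sojourn_integrand (n : ℕ) (x : ℕ → ℝ) : Measurable fun s =>
    (Set.Ici (0 : ℝ)).indicator (fun _ => (1 : ℝ)) (stepProcess n x s) :=
  (measurable_const.indicator measurableSet_Ici).comp (measurable_stepProcess n x)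

theorem intervalIntegrable_sojourn (n : ℕ) (x : ℕ → ℝ) (a b : ℝ) : IntervalIntegrable (fun s =>
    (Set.Ici (0 : ℝ)).indicator (fun _ => (1 : ℝ)) (stepProcess n x s)) volume a b := by
  refine (intervalIntegrable_const (c := (1 : ℝ))).mono_fun'
    (measurable_sojourn_integrand n x).aestronglyMeasurable (Eventually.of_forall fun s => ?_)
  simp only [Set.indicator_apply]
  split_ifs <;> simp

theorem continuous_sojournTime (n : ℕ) (x : ℕ → ℝ) : Continuous (sojournTime n x) :=
  intervalIntegral.continuous_primitive (intervalIntegrable_sojourn n x) 0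

theorem sojournTime_nonneg (n : ℕ) (x : ℕ → ℝ) {t : ℝ} (ht : 0 ≤ t) : 0 ≤ sojournTime n x t :=
  intervalIntegral.integral_nonneg ht fun _ _ =>
    Set.indicator_nonneg (fun _ _ => zero_le_one) _

theorem measurable_integrand (lam : ℂ) (μ ν : ℝ) (n : ℕ) (x : ℕ → ℝ) :
    Measurable (integrand lam μ ν n x) := by
  have h1 := measurable_stepProcess n x
  have h2 := (continuous_sojournTime n x).measurable
  unfold integrand
  fun_prop

theorem norm_integrand_le {lam : ℂ} {μ ν : ℝ} (hν : 0 < ν) (n : ℕ) (x : ℕ → ℝ) {t : ℝ}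
    (ht : 0 ≤ t) : ‖integrand lam μ ν n x t‖ ≤ Real.exp (-lam.re * t) := by
  rw [integrand, Complex.norm_exp]
  have := mul_nonneg hν.le (sojournTime_nonneg n x ht)
  simpa using this

theorem integrableOn_integrand {lam : ℂ} (hlam : 0 < lam.re) (μ : ℝ) {ν : ℝ} (hν : 0 < ν) (n : ℕ)
    (x : ℕ → ℝ) : IntegrableOn (integrand lam μ ν n x) (Set.Ioi 0) := by
  refine (exp_neg_integrableOn_Ioi 0 hlam).mono'
    (measurable_integrand lam μ ν n x).aestronglyMeasurable ?_
  filter_upwards [ae_restrict_mem measurableSet_Ioi] with t ht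
  exact norm_integrand_le hν n x (le_of_lt ht)

theorem sojournTime_add (n : ℕ) (x : ℕ → ℝ) (k : ℕ) {s : ℝ} (h0 : 0 ≤ s) (h1 : s ≤ 1 / 2 ^ n) :
    sojournTime n x (s + k / 2 ^ n) =
      sojournTime n x (k / 2 ^ n) + if 0 ≤ x k then s else 0 := by
  unfold sojournTime
  rw [← intervalIntegral.integral_add_adjacent_intervals
    (intervalIntegrable_sojourn n x 0 (k / 2 ^ n)) (intervalIntegrable_sojourn n x _ _)]
  congr 1
  have hle : (k : ℝ) / 2 ^ n ≤ s + k / 2 ^ n := by linarith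
  have : ∫ t in ((k : ℝ) / 2 ^ n)..(s + k / 2 ^ n),
      (Set.Ici (0 : ℝ)).indicator (fun _ => (1 : ℝ)) (stepProcess n x t) =
      ∫ t in ((k : ℝ) / 2 ^ n)..(s + k / 2 ^ n), if 0 ≤ x k then (1 : ℝ) else 0 := by
    refine intervalIntegral.integral_congr_ae ?_
    filter_upwards [Measure.ae_ne volume (s + k / 2 ^ n)] with t hne ht
    rw [Set.uIoc_of_le hle] at ht
    rw [stepProcess_eq n x k ht.1.le]
    · simp [Set.indicator_apply]
    · rw [add_div, add_comm]
      exact lt_of_lt_of_le (lt_of_le_of_ne ht.2 hne) (by linarith)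
  rw [this, intervalIntegral.integral_const]
  split_ifs <;> simp

/-- The first `k` cells contribute to the sojourn time according to the signs of
`x_0, …, x_{k - 1}`. -/
theorem exp_sojournTime (ν : ℝ) (n : ℕ) (x : ℕ → ℝ) (k : ℕ) :
    Real.exp (-(ν * sojournTime n x (k / 2 ^ n))) =
      ∏ j ∈ Finset.range k, visitWeight (Real.exp (-(ν * (1 / 2 ^ n)))) (x j) := by
  induction k with
  | zero => simp [sojournTime]
  | succ k ih =>
    rw [Finset.prod_range_succ, ← ih]
    have : ((k + 1 : ℕ) : ℝ) / 2 ^ n = 1 / 2 ^ n + k / 2 ^ n := by push_cast; ring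
    rw [this, sojournTime_add n x k (by positivity) le_rfl, mul_add, neg_add, Real.exp_add]
    unfold visitWeight
    split_ifs <;> simp

theorem integral_integrand_cell (lam : ℂ) (μ ν : ℝ) (n : ℕ) (x : ℕ → ℝ) (k : ℕ) :
    ∫ t in ((k : ℝ) / 2 ^ n)..((k + 1 : ℝ) / 2 ^ n), integrand lam μ ν n x t =
      Complex.exp (-(lam * (1 / 2 ^ n))) ^ k * Complex.exp (Complex.I * μ * x k) *
        ((∏ j ∈ Finset.range k, visitWeight (Real.exp (-(ν * (1 / 2 ^ n)))) (x j) : ℝ) : ℂ) *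
        holdingFactor lam ν n (x k) := by
  have e1 : (k + 1 : ℝ) / 2 ^ n = 1 / 2 ^ n + k / 2 ^ n := by ring
  have h0 : (0 : ℝ) ≤ 1 / 2 ^ n := by positivity
  have e0 : (k : ℝ) / 2 ^ n = 0 + k / 2 ^ n := by ring
  rw [e1]
  nth_rewrite 1 [e0]
  rw [← intervalIntegral.integral_comp_add_right, holdingFactor,
    ← intervalIntegral.integral_const_mul]
  refine intervalIntegral.integral_congr_ae ?_
  filter_upwards [Measure.ae_ne volume (1 / 2 ^ n : ℝ)] with s hne hs
  rw [Set.uIoc_of_le h0] at hs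
  have hlt : s < 1 / 2 ^ n := lt_of_le_of_ne hs.2 hne
  rw [integrand, sojournTime_add n x k hs.1.le hs.2, stepProcess_eq n x k (by linarith [hs.1])
    (by rw [e1]; linarith), ← exp_sojournTime, ← Complex.exp_nat_mul, Complex.ofReal_exp,
    ← Complex.exp_add, ← Complex.exp_add, ← Complex.exp_add]
  congr 1
  split_ifs <;> push_cast <;> ring

theorem hasSum_integral_cells {g : ℝ → ℂ} (hg : IntegrableOn g (Set.Ioi 0)) (n : ℕ) :
    HasSum (fun k : ℕ => ∫ t in ((k : ℝ) / 2 ^ n)..((k + 1 : ℝ) / 2 ^ n), g t)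
      (∫ t in Set.Ioi (0 : ℝ), g t) := by
  set f : ℕ → ℝ := fun k => (k : ℝ) / 2 ^ n with hf
  have hmono : Monotone f := fun a b h => by simp only [hf]; gcongr
  have hU : (⋃ k : ℕ, Set.Ioc (f k) (f (Order.succ k))) = Set.Ioi (0 : ℝ) := by
    have := iUnion_Ioc_map_succ_eq_Ioi (f := f) (fun a => hmono bot_le) ?_
    · simpa [hf] using this
    · have : Tendsto f atTop atTop :=
        tendsto_natCast_atTop_atTop.atTop_div_const (by positivity)
      exact not_bddAbove_of_tendsto_atTop this
  have h := hasSum_integral_iUnion (μ := volume) (f := g)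
    (s := fun k => Set.Ioc (f k) (f (Order.succ k))) (fun k => measurableSet_Ioc)
    hmono.pairwise_disjoint_on_Ioc_succ (by rwa [hU])
  rw [hU] at h
  refine Eq.mpr (congrArg (fun g => HasSum g _) (funext fun k => ?_)) h
  rw [intervalIntegral.integral_of_le (by gcongr; linarith)]
  simp [hf]

/-! ### Paths of finitely many observations -/

theorem pathOf_restrict (x : ℕ → ℝ) (hx : x 0 = 0) {k j : ℕ} (hj : j ≤ k) :
    pathOf (fun i : Fin k => x ((i : ℕ) + 1)) j = x j := by
  cases j with
  | zero => rw [pathOf, hx]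
  | succ j => rw [pathOf, dif_pos (by omega)]

theorem pathOf_snoc {k : ℕ} (y : Fin k → ℝ) (a : ℝ) {j : ℕ} (hj : j ≤ k) :
    pathOf (Fin.snoc y a : Fin (k + 1) → ℝ) j = pathOf y j := by
  cases j with
  | zero => rfl
  | succ j =>
    rw [pathOf, pathOf, dif_pos (by omega), dif_pos (by omega)]
    exact Fin.snoc_castSucc (α := fun _ => ℝ) a y ⟨j, by omega⟩

theorem pathOf_snoc_last {k : ℕ} (y : Fin k → ℝ) (a : ℝ) :
    pathOf (Fin.snoc y a : Fin (k + 1) → ℝ) (k + 1) = a := by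
  rw [pathOf, dif_pos (by omega)]
  exact Fin.snoc_last (α := fun _ => ℝ) a y

theorem continuous_pathOf {k : ℕ} (j : ℕ) : Continuous fun y : Fin k → ℝ => pathOf y j := by
  cases j with
  | zero => exact continuous_const
  | succ j =>
    by_cases h : j < k
    · simp only [pathOf, dif_pos h]; fun_prop
    · simp only [pathOf, dif_neg h]; fun_prop

/-- The product of the visit weights of all observations `x_1, …, x_k`. -/
noncomputable def pathWeight (w : ℝ) {k : ℕ} (y : Fin k → ℝ) : ℝ := ∏ i, visitWeight w (y i)

theorem measurable_pathWeight (w : ℝ) (k : ℕ) : Measurable fun y : Fin k → ℝ => pathWeight w y :=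
  Finset.measurable_prod _ fun i _ => (measurable_visitWeight w).comp (measurable_pi_apply i)

theorem pathWeight_nonneg {w : ℝ} (hw : 0 < w) {k : ℕ} (y : Fin k → ℝ) : 0 ≤ pathWeight w y :=
  Finset.prod_nonneg fun _ _ => (visitWeight_pos hw _).le

theorem pathWeight_le_one {w : ℝ} (hw : 0 < w) (hw1 : w ≤ 1) {k : ℕ} (y : Fin k → ℝ) :
    pathWeight w y ≤ 1 :=
  Finset.prod_le_one (fun _ _ => (visitWeight_pos hw _).le) fun _ _ => visitWeight_le_one hw1 _

theorem pathWeight_snoc (w : ℝ) {k : ℕ} (y : Fin k → ℝ) (a : ℝ) :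
    pathWeight w (Fin.snoc y a : Fin (k + 1) → ℝ) = pathWeight w y * visitWeight w a := by
  rw [pathWeight, Fin.prod_univ_castSucc]
  simp [pathWeight]

/-- The visits at the times `0, …, k - 1` weigh as much as those at the times `1, …, k`, up to
the weight `w` of the visit at time `0` and the weight of the last visit. -/
theorem prod_visitWeight_mul (w : ℝ) {k : ℕ} (y : Fin k → ℝ) :
    (∏ j ∈ Finset.range k, visitWeight w (pathOf y j)) * visitWeight w (pathOf y k) =
      w * pathWeight w y := by
  rw [← Finset.prod_range_succ, Finset.prod_range_succ', mul_comm]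
  congr 1
  · simp [pathOf, visitWeight]
  · rw [← Fin.prod_univ_eq_prod_range (fun j => visitWeight w (pathOf y (j + 1))), pathWeight]
    refine Finset.prod_congr rfl fun i _ => ?_
    rw [pathOf, dif_pos i.2]

theorem slice_eq (lam : ℂ) (μ ν : ℝ) (n k : ℕ) (y : Fin k → ℝ) :
    slice lam μ ν n k y =
      Complex.exp (-(lam * (1 / 2 ^ n))) ^ k * Complex.exp (Complex.I * μ * pathOf y k) *
        ((∏ j ∈ Finset.range k,
          visitWeight (Real.exp (-(ν * (1 / 2 ^ n)))) (pathOf y j) : ℝ) : ℂ) *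
        holdingFactor lam ν n (pathOf y k) :=
  integral_integrand_cell lam μ ν n (pathOf y) k

theorem measurable_holdingFactor (lam : ℂ) (ν : ℝ) (n : ℕ) :
    Measurable (holdingFactor lam ν n) := by
  have : holdingFactor lam ν n = fun x => if 0 ≤ x then holdingFactor lam ν n 0
      else holdingFactor lam ν n (-1) := by
    ext x
    unfold holdingFactor
    split_ifs <;> simp_all
    linarith
  rw [this]
  exact Measurable.ite measurableSet_Ici measurable_const measurable_const

theorem isTame_slice {lam : ℂ} (hlam : 0 < lam.re) (μ : ℝ) {ν : ℝ} (hν : 0 < ν) (n k : ℕ) :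
    IsTame (slice lam μ ν n k) := by
  constructor
  · have h : slice lam μ ν n k = _ := funext fun y => slice_eq lam μ ν n k y
    rw [h]
    have h1 := measurable_holdingFactor lam ν n
    have h2 := measurable_visitWeight (Real.exp (-(ν * (1 / 2 ^ n))))
    have h3 : ∀ j, Measurable fun y : Fin k → ℝ => pathOf y j := fun j =>
      (continuous_pathOf j).measurable
    refine Measurable.mul (Measurable.mul ?_ ?_) (h1.comp (h3 k))
    · have := h3 k
      fun_prop
    · exact Complex.measurable_ofReal.comp
        (Finset.measurable_prod _ fun j _ => h2.comp (h3 j))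
  · refine ⟨1 * |((k + 1 : ℝ) / 2 ^ n) - (k : ℝ) / 2 ^ n|, fun y => ?_⟩
    refine intervalIntegral.norm_integral_le_of_norm_le_const fun t ht => ?_
    rw [Set.uIoc_of_le (by gcongr; linarith)] at ht
    have h0 : 0 ≤ t := le_trans (by positivity) ht.1.le
    refine (norm_integrand_le hν n _ h0).trans ?_
    rw [Real.exp_le_one_iff]
    nlinarith

theorem hasSum_slice {lam : ℂ} (hlam : 0 < lam.re) (μ : ℝ) {ν : ℝ} (hν : 0 < ν) (n : ℕ)
    (x : ℕ → ℝ) (hx : x 0 = 0) :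
    HasSum (fun k => slice lam μ ν n k fun j => x ((j : ℕ) + 1))
      (laplaceFunctional lam μ ν n x) := by
  refine Eq.mpr (congrArg (fun g => HasSum g _) (funext fun k => ?_))
    (hasSum_integral_cells (integrableOn_integrand hlam μ hν n x) n)
  have h : ∀ w, ∏ j ∈ Finset.range k, visitWeight w (pathOf (fun i : Fin k => x ((i : ℕ) + 1)) j)
      = ∏ j ∈ Finset.range k, visitWeight w (x j) := fun w =>
    Finset.prod_congr rfl fun j hj => by rw [pathOf_restrict x hx (Finset.mem_range.mp hj).le]
  rw [integral_integrand_cell, slice_eq, pathOf_restrict x hx le_rfl, h]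

/-! ### Pseudo-expectations of functionals of the walk -/

theorem ofReal_re_kernel {N : ℕ} (hE : Even N) (t x : ℝ) :
    ((kernel N t x).re : ℂ) = kernel N t x :=
  Complex.ext rfl (by simp [im_kernel hE])

theorem ofReal_re_density {N : ℕ} (hE : Even N) (n : ℕ) {k : ℕ} (y : Fin k → ℝ) :
    ((density N n y).re : ℂ) = density N n y := by
  have : density N n y = ((∏ j : Fin k, (kernel N (1 / 2 ^ n)
      (pathOf y (j : ℕ) - pathOf y ((j : ℕ) + 1))).re : ℝ) : ℂ) := by
    rw [Complex.ofReal_prod]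
    exact Finset.prod_congr rfl fun j _ => (ofReal_re_kernel hE _ _).symm
  rw [this, Complex.ofReal_re]

theorem continuous_density {N : ℕ} (hN : 2 ≤ N) (hE : Even N) (n k : ℕ) :
    Continuous fun y : Fin k → ℝ => density N n y :=
  continuous_finsetProd _ fun j _ => (continuous_kernel hN hE (by positivity)).comp
    ((continuous_pathOf _).sub (continuous_pathOf _))

theorem density_snoc (N n : ℕ) {k : ℕ} (y : Fin k → ℝ) (a : ℝ) :
    density N n (Fin.snoc y a : Fin (k + 1) → ℝ) =
      density N n y * kernel N (1 / 2 ^ n) (pathOf y k - a) := by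
  rw [density, Fin.prod_univ_castSucc, density]
  congr 1
  · refine Finset.prod_congr rfl fun j _ => ?_
    rw [Fin.val_castSucc, pathOf_snoc y a (by omega), pathOf_snoc y a (by omega)]
  · rw [Fin.val_last, pathOf_snoc y a le_rfl, pathOf_snoc_last]

theorem measurePreserving_snoc (k : ℕ) :
    MeasurePreserving (MeasurableEquiv.piFinSuccAbove (fun _ : Fin (k + 1) => ℝ) (Fin.last k)).symm :=
  (volume_preserving_piFinSuccAbove (fun _ => ℝ) (Fin.last k)).symm

theorem piFinSuccAbove_symm_apply_last {k : ℕ} (p : ℝ × (Fin k → ℝ)) :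
    (MeasurableEquiv.piFinSuccAbove (fun _ : Fin (k + 1) => ℝ) (Fin.last k)).symm p =
      Fin.snoc p.2 p.1 :=
  Fin.insertNth_last' p.1 p.2

theorem integrable_snoc_iff {k : ℕ} (G : (Fin (k + 1) → ℝ) → ℂ) :
    Integrable (fun p : ℝ × (Fin k → ℝ) => G (Fin.snoc p.2 p.1)) ↔ Integrable G := by
  rw [← (measurePreserving_snoc k).integrable_comp_emb (MeasurableEquiv.measurableEmbedding _)]
  simp only [Function.comp_def, piFinSuccAbove_symm_apply_last]

theorem integral_snoc {k : ℕ} {G : (Fin (k + 1) → ℝ) → ℂ} (hG : Integrable G) :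
    ∫ y, G y = ∫ y : Fin k → ℝ, ∫ a : ℝ, G (Fin.snoc y a) := by
  rw [← (measurePreserving_snoc k).integral_comp (MeasurableEquiv.measurableEmbedding _)]
  simp only [piFinSuccAbove_symm_apply_last]
  exact integral_prod_symm _ ((integrable_snoc_iff G).mpr hG)

theorem integrable_density {N : ℕ} (hN : 2 ≤ N) (hE : Even N) (n k : ℕ) :
    Integrable fun y : Fin k → ℝ => density N n y := by
  have ht : (0 : ℝ) < 1 / 2 ^ n := by positivity
  induction k with
  | zero =>
    rw [volume_pi, Measure.pi_of_empty]
    exact Integrable.of_finite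
  | succ k ih =>
    rw [← integrable_snoc_iff]
    simp only [density_snoc]
    have hc : Continuous fun p : ℝ × (Fin k → ℝ) =>
        density N n p.2 * kernel N (1 / 2 ^ n) (pathOf p.2 k - p.1) :=
      ((continuous_density hN hE n k).comp continuous_snd).mul
        ((continuous_kernel hN hE ht).comp
          (((continuous_pathOf k).comp continuous_snd).sub continuous_fst))
    have hk : ∀ y : Fin k → ℝ, Integrable fun a => kernel N (1 / 2 ^ n) (pathOf y k - a) :=
      fun y => (integrable_kernel hN hE ht).comp_sub_left (pathOf y k)
    have hi : ∀ y : Fin k → ℝ, Integrable fun a =>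
        density N n y * kernel N (1 / 2 ^ n) (pathOf y k - a) := fun y => (hk y).const_mul _
    refine (integrable_prod_iff' hc.aestronglyMeasurable).mpr ⟨Eventually.of_forall hi, ?_⟩
    simp only [norm_mul, integral_const_mul]
    have : ∀ y : Fin k → ℝ, ∫ a, ‖kernel N (1 / 2 ^ n) (pathOf y k - a)‖ =
        ∫ a, ‖kernel N (1 / 2 ^ n) a‖ := fun y =>
      integral_sub_left_eq_self (fun a => ‖kernel N (1 / 2 ^ n) a‖) volume (pathOf y k)
    simp only [this]
    exact ih.norm.mul_const _

theorem integrable_mul_density {N : ℕ} (hN : 2 ≤ N) (hE : Even N) (n : ℕ) {k : ℕ}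
    {F : (Fin k → ℝ) → ℂ} (hF : IsTame F) : Integrable fun y => F y * density N n y := by
  obtain ⟨hm, C, hC⟩ := hF
  exact (integrable_density hN hE n k).bdd_mul hm.aestronglyMeasurable (Eventually.of_forall hC)

theorem integral_exp_mul_kernel_sub {N : ℕ} (hN : 2 ≤ N) (hE : Even N) {t : ℝ} (ht : 0 < t)
    (μ x : ℝ) : ∫ a : ℝ, Complex.exp (Complex.I * μ * a) * kernel N t (x - a) =
      Complex.exp (Complex.I * μ * x) * symbol N t μ := by
  rw [← integral_exp_mul_kernel hN hE ht μ, ← integral_const_mul,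
    ← integral_add_right_eq_self _ x]
  congr 1
  ext a
  rw [← mul_assoc, ← Complex.exp_add, ← kernel_neg hE t a]
  congr 2
  · push_cast; ring
  · ring

/-- The pseudo-expectation of `exp (i μ x_k)` over `x_k ∈ S`, in which every visit of `[0, ∞)` at
one of the times `1, …, k` is weighted by `w`. -/
noncomputable def walkTransform (N n : ℕ) (w : ℝ) (S : Set ℝ) (k : ℕ) (μ : ℝ) : ℂ :=
  ∫ y : Fin k → ℝ, Complex.exp (Complex.I * μ * pathOf y k) *
    ((S.indicator (fun _ => 1) (pathOf y k) * pathWeight w y * (density N n y).re : ℝ) : ℂ)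

theorem measurable_walk_density {N : ℕ} (hN : 2 ≤ N) (hE : Even N) (n : ℕ) (w : ℝ) {S : Set ℝ}
    (hS : MeasurableSet S) (k : ℕ) : Measurable fun y : Fin k → ℝ =>
      S.indicator (fun _ => (1 : ℝ)) (pathOf y k) * pathWeight w y * (density N n y).re :=
  (((measurable_const.indicator hS).comp (continuous_pathOf k).measurable).mul
    (measurable_pathWeight w k)).mul
    (Complex.measurable_re.comp (continuous_density hN hE n k).measurable)

theorem integrable_walk_density {N : ℕ} (hN : 2 ≤ N) (hE : Even N) (n : ℕ) {w : ℝ} (hw : 0 < w)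
    (hw1 : w ≤ 1) {S : Set ℝ} (hS : MeasurableSet S) (k : ℕ) : Integrable fun y : Fin k → ℝ =>
      S.indicator (fun _ => (1 : ℝ)) (pathOf y k) * pathWeight w y * (density N n y).re := by
  refine (integrable_density hN hE n k).norm.mono'
    (measurable_walk_density hN hE n w hS k).aestronglyMeasurable
    (Eventually.of_forall fun y => ?_)
  rw [norm_mul, norm_mul, Real.norm_of_nonneg (pathWeight_nonneg hw y)]
  have h1 : ‖S.indicator (fun _ => (1 : ℝ)) (pathOf y k)‖ ≤ 1 := by
    by_cases h : pathOf y k ∈ S <;> simp [h]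
  have h2 := pathWeight_le_one hw hw1 y
  have h3 := pathWeight_nonneg hw y
  calc _ ≤ 1 * 1 * ‖density N n y‖ := by
        gcongr
        exact Complex.abs_re_le_norm _
    _ = _ := by ring

theorem walkTransform_mem {N : ℕ} (hN : 2 ≤ N) (hE : Even N) (n : ℕ) {w : ℝ} (hw : 0 < w)
    (hw1 : w ≤ 1) {S : Set ℝ} (hS : MeasurableSet S) (hadd : ∀ x ∈ S, ∀ y ∈ S, x + y ∈ S) (k : ℕ) :
    walkTransform N n w S k ∈ signedCharFun S hS hadd :=
  integral_exp_mem_signedCharFun (measurable_walk_density hN hE n w hS k)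
    (integrable_walk_density hN hE n hw hw1 hS k) (continuous_pathOf k).measurable
    fun y hy => by
      by_contra h
      simp [h] at hy

theorem integrable_exp_mul_walk_density {N : ℕ} (hN : 2 ≤ N) (hE : Even N) (n : ℕ) {w : ℝ}
    (hw : 0 < w) (hw1 : w ≤ 1) {S : Set ℝ} (hS : MeasurableSet S) (k : ℕ) (μ : ℝ) :
    Integrable fun y : Fin k → ℝ => Complex.exp (Complex.I * μ * pathOf y k) *
      ((S.indicator (fun _ => 1) (pathOf y k) * pathWeight w y * (density N n y).re : ℝ) : ℂ) := by
  have hc := continuous_pathOf (k := k) k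
  refine (integrable_walk_density hN hE n hw hw1 hS k).ofReal.bdd_mul (c := 1)
    (by fun_prop) (Eventually.of_forall fun y => ?_)
  rw [mul_assoc, mul_comm Complex.I, ← Complex.ofReal_mul, Complex.norm_exp_ofReal_mul_I]

theorem indicator_Ici_add_indicator_Iio (x : ℝ) :
    (Set.Ici (0 : ℝ)).indicator (fun _ => (1 : ℝ)) x +
      (Set.Iio (0 : ℝ)).indicator (fun _ => (1 : ℝ)) x = 1 := by
  by_cases h : 0 ≤ x
  · simp [h]
  · simp [h, not_le.mp h]

theorem walkTransform_add {N : ℕ} (hN : 2 ≤ N) (hE : Even N) (n : ℕ) {w : ℝ} (hw : 0 < w)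
    (hw1 : w ≤ 1) (k : ℕ) (μ : ℝ) :
    walkTransform N n w (Set.Ici 0) k μ + walkTransform N n w (Set.Iio 0) k μ =
      ∫ y : Fin k → ℝ, Complex.exp (Complex.I * μ * pathOf y k) * pathWeight w y *
        density N n y := by
  rw [walkTransform, walkTransform, ← integral_add
    (integrable_exp_mul_walk_density hN hE n hw hw1 (measurableSet_Ici (a := 0)) k μ)
    (integrable_exp_mul_walk_density hN hE n hw hw1 (measurableSet_Iio (a := 0)) k μ)]
  congr 1
  ext y
  rw [← mul_add, ← Complex.ofReal_add, ← add_mul, ← add_mul, indicator_Ici_add_indicator_Iio,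
    one_mul, Complex.ofReal_mul, ofReal_re_density hE, ← mul_assoc]

theorem walkTransform_zero {N : ℕ} (hN : 2 ≤ N) (hE : Even N) (n : ℕ) {w : ℝ} (hw : 0 < w)
    (hw1 : w ≤ 1) (μ : ℝ) :
    walkTransform N n w (Set.Ici 0) 0 μ + walkTransform N n w (Set.Iio 0) 0 μ = 1 := by
  rw [walkTransform_add hN hE n hw hw1]
  rw [volume_pi, Measure.pi_of_empty]
  simp [pathOf, pathWeight, density]

/-- One step of the walk multiplies the transform by the symbol. On the left the weight of the
visit at the new point is removed. -/
theorem walkTransform_succ {N : ℕ} (hN : 2 ≤ N) (hE : Even N) (n : ℕ) {w : ℝ} (hw : 0 < w)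
    (hw1 : w ≤ 1) (k : ℕ) (μ : ℝ) :
    (w⁻¹ : ℝ) * walkTransform N n w (Set.Ici 0) (k + 1) μ +
        walkTransform N n w (Set.Iio 0) (k + 1) μ =
      symbol N (1 / 2 ^ n) μ *
        (walkTransform N n w (Set.Ici 0) k μ + walkTransform N n w (Set.Iio 0) k μ) := by
  have i1 := (integrable_exp_mul_walk_density hN hE n hw hw1 (measurableSet_Ici (a := 0))
    (k + 1) μ).const_mul ((w⁻¹ : ℝ) : ℂ)
  have i2 := integrable_exp_mul_walk_density hN hE n hw hw1 (measurableSet_Iio (a := 0)) (k + 1) μ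
  rw [walkTransform_add hN hE n hw hw1, walkTransform, walkTransform, ← integral_const_mul,
    ← integral_add i1 i2, integral_snoc (by exact i1.add i2), ← integral_const_mul]
  congr 1
  ext y
  calc _ = ∫ a : ℝ, (pathWeight w y * density N n y) *
        (Complex.exp (Complex.I * μ * a) * kernel N (1 / 2 ^ n) (pathOf y k - a)) := by
        congr 1
        ext a
        simp only [Complex.ofReal_mul, ofReal_re_density hE]
        simp only [Complex.ofReal_mul, pathOf_snoc_last, pathWeight_snoc, density_snoc]
        have : ((w⁻¹ : ℝ) : ℂ) * ((Set.Ici (0 : ℝ)).indicator (fun _ => (1 : ℝ)) a : ℝ) *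
            (visitWeight w a : ℝ) + ((Set.Iio (0 : ℝ)).indicator (fun _ => (1 : ℝ)) a : ℝ) *
            (visitWeight w a : ℝ) = 1 := by
          have hw' : (w : ℂ) ≠ 0 := by exact_mod_cast hw.ne'
          by_cases h : 0 ≤ a
          · simp [visitWeight, h, hw']
          · simp [visitWeight, h, not_le.mp h]
        linear_combination (Complex.exp (Complex.I * μ * a) * pathWeight w y * density N n y *
          kernel N (1 / 2 ^ n) (pathOf y k - a)) * this
    _ = _ := by
        rw [integral_const_mul, integral_exp_mul_kernel_sub hN hE (by positivity)]
        ring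

/-- The visit at time `0` always counts and the visit at time `k` does not yet count in the cell
`[k / 2 ^ n, (k + 1) / 2 ^ n)`. The former costs the factor `w`, and the latter, for `x_k ≥ 0`,
saves it. -/
theorem expectation_slice {N : ℕ} (hN : 2 ≤ N) (hE : Even N) (lam : ℂ) (μ : ℝ) {ν : ℝ}
    (hν : 0 < ν) (n k : ℕ) :
    expectation N n (slice lam μ ν n k) =
      (holdingFactor lam ν n 0 * walkTransform N n (Real.exp (-(ν * (1 / 2 ^ n)))) (Set.Ici 0) k μ +
        Real.exp (-(ν * (1 / 2 ^ n))) * holdingFactor lam ν n (-1) *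
          walkTransform N n (Real.exp (-(ν * (1 / 2 ^ n)))) (Set.Iio 0) k μ) *
      Complex.exp (-(lam * (1 / 2 ^ n))) ^ k := by
  set w := Real.exp (-(ν * (1 / 2 ^ n))) with hw
  have hw0 : 0 < w := Real.exp_pos _
  have hw1 : w ≤ 1 := Real.exp_le_one_iff.mpr (by have : 0 ≤ ν * (1 / 2 ^ n) := by positivity
                                                  linarith)
  have i1 := (integrable_exp_mul_walk_density hN hE n hw0 hw1 (measurableSet_Ici (a := 0))
    k μ).const_mul (holdingFactor lam ν n 0)
  have i2 := (integrable_exp_mul_walk_density hN hE n hw0 hw1 (measurableSet_Iio (a := 0)) k μ).const_mul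
    (w * holdingFactor lam ν n (-1))
  rw [walkTransform, walkTransform, ← integral_const_mul, ← integral_const_mul,
    ← integral_add i1 i2, ← integral_mul_const, expectation]
  congr 1
  ext y
  have hp := congrArg (fun r : ℝ => (r : ℂ)) (prod_visitWeight_mul w y)
  simp only [Complex.ofReal_mul] at hp
  rw [slice_eq, ← hw]
  simp only [Complex.ofReal_mul, ofReal_re_density hE]
  have hw' : (w : ℂ) ≠ 0 := by exact_mod_cast hw0.ne'
  by_cases h : 0 ≤ pathOf y k
  · have hh : holdingFactor lam ν n (pathOf y k) = holdingFactor lam ν n 0 := by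
      simp [holdingFactor, h]
    rw [visitWeight, if_pos h, mul_comm] at hp
    rw [hh, mul_left_cancel₀ hw' hp]
    simp [h]
    ring
  · have hh : holdingFactor lam ν n (pathOf y k) = holdingFactor lam ν n (-1) := by
      simp only [holdingFactor, if_neg h]
      norm_num
    rw [visitWeight, if_neg h, Complex.ofReal_one, mul_one] at hp
    rw [hh, hp]
    simp [h, not_le.mp h]
    ring

/-! ### The transform of the kernel over a half-line -/

theorem kernel_eq_scaled {N : ℕ} (hN : 2 ≤ N) (hE : Even N) {t : ℝ} (ht : 0 < t) (x : ℝ) :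
    kernel N t x =
      ((t ^ (1 / N : ℝ))⁻¹ : ℝ) * kernel N 1 ((t ^ (1 / N : ℝ))⁻¹ * x) := by
  have hr : 0 < t ^ (1 / N : ℝ) := Real.rpow_pos_of_pos ht _
  have hp : (t ^ (1 / N : ℝ)) ^ N = t := by
    rw [one_div]
    exact Real.rpow_inv_natCast_pow ht.le (by omega)
  have h := kernel_scaling hE hr ((t ^ (1 / N : ℝ))⁻¹ * x)
  rwa [hp, mul_inv_cancel_left₀ hr.ne'] at h

/-- By scaling, the total variation of the kernel is the same at all times. -/
theorem integral_norm_kernel {N : ℕ} (hN : 2 ≤ N) (hE : Even N) {t : ℝ} (ht : 0 < t) :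
    ∫ x, ‖kernel N t x‖ = ∫ x, ‖kernel N 1 x‖ := by
  have hr : 0 < t ^ (1 / N : ℝ) := Real.rpow_pos_of_pos ht _
  have h := Measure.integral_comp_mul_left (fun x => ‖kernel N 1 x‖) (t ^ (1 / N : ℝ))⁻¹
  rw [inv_inv, abs_of_pos hr, smul_eq_mul] at h
  simp_rw [kernel_eq_scaled hN hE ht, norm_mul, Complex.norm_real, Real.norm_of_nonneg
    (inv_nonneg.mpr hr.le)]
  rw [integral_const_mul, h, inv_mul_cancel_left₀ hr.ne']

/-- The part over `S` of the Fourier integral of the kernel. -/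
noncomputable def partTransform (N : ℕ) (S : Set ℝ) (t μ : ℝ) : ℂ :=
  ∫ x : ℝ, Complex.exp (Complex.I * μ * x) *
    ((S.indicator (fun _ => 1) x * (kernel N t x).re : ℝ) : ℂ)

theorem norm_exp_I_mul (μ x : ℝ) : ‖Complex.exp (Complex.I * μ * x)‖ = 1 := by
  rw [mul_assoc, mul_comm Complex.I, ← Complex.ofReal_mul, Complex.norm_exp_ofReal_mul_I]

theorem norm_indicator_mul_kernel_le (N : ℕ) (S : Set ℝ) (t x : ℝ) :
    ‖S.indicator (fun _ => (1 : ℝ)) x * (kernel N t x).re‖ ≤ ‖kernel N t x‖ := by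
  by_cases h : x ∈ S
  · simpa [h] using Complex.abs_re_le_norm (kernel N t x)
  · simp [h]

theorem integrable_indicator_mul_kernel {N : ℕ} (hN : 2 ≤ N) (hE : Even N) {S : Set ℝ}
    (hS : MeasurableSet S) {t : ℝ} (ht : 0 < t) :
    Integrable fun x => S.indicator (fun _ => (1 : ℝ)) x * (kernel N t x).re :=
  (integrable_kernel hN hE ht).norm.mono'
    ((measurable_const.indicator hS).mul (Complex.measurable_re.comp
      (continuous_kernel hN hE ht).measurable)).aestronglyMeasurable
    (Eventually.of_forall fun x => norm_indicator_mul_kernel_le N S t x)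

theorem integrable_partTransform {N : ℕ} (hN : 2 ≤ N) (hE : Even N) {S : Set ℝ}
    (hS : MeasurableSet S) {t : ℝ} (ht : 0 < t) (μ : ℝ) :
    Integrable fun x : ℝ => Complex.exp (Complex.I * μ * x) *
      ((S.indicator (fun _ => 1) x * (kernel N t x).re : ℝ) : ℂ) :=
  (integrable_indicator_mul_kernel hN hE hS ht).ofReal.bdd_mul (c := 1) (by fun_prop)
    (Eventually.of_forall fun x => (norm_exp_I_mul μ x).le)

theorem partTransform_mem {N : ℕ} (hN : 2 ≤ N) (hE : Even N) {S : Set ℝ}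
    (hS : MeasurableSet S) (hadd : ∀ x ∈ S, ∀ y ∈ S, x + y ∈ S) {t : ℝ} (ht : 0 < t) :
    partTransform N S t ∈ signedCharFun S hS hadd :=
  integral_exp_mem_signedCharFun
    ((measurable_const.indicator hS).mul (Complex.measurable_re.comp
      (continuous_kernel hN hE ht).measurable))
    (integrable_indicator_mul_kernel hN hE hS ht) measurable_id
    fun x hx => by
      by_contra h
      exact hx (by simp [show x ∉ S from h])

theorem partTransform_add {N : ℕ} (hN : 2 ≤ N) (hE : Even N) {t : ℝ} (ht : 0 < t) (μ : ℝ) :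
    partTransform N (Set.Ici 0) t μ + partTransform N (Set.Iio 0) t μ = symbol N t μ := by
  rw [partTransform, partTransform, ← integral_add
    (integrable_partTransform hN hE (measurableSet_Ici (a := 0)) ht μ)
    (integrable_partTransform hN hE (measurableSet_Iio (a := 0)) ht μ),
    ← integral_exp_mul_kernel hN hE ht]
  congr 1
  ext x
  rw [← mul_add, ← Complex.ofReal_add, ← add_mul, indicator_Ici_add_indicator_Iio, one_mul,
    ofReal_re_kernel hE]

theorem norm_partTransform_le {N : ℕ} (hN : 2 ≤ N) (hE : Even N) (S : Set ℝ) {t : ℝ} (ht : 0 < t)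
    (μ : ℝ) : ‖partTransform N S t μ‖ ≤ ∫ x, ‖kernel N 1 x‖ := by
  rw [← integral_norm_kernel hN hE ht]
  refine norm_integral_le_of_norm_le (integrable_kernel hN hE ht).norm
    (Eventually.of_forall fun x => ?_)
  rw [norm_mul, norm_exp_I_mul, one_mul, Complex.norm_real]
  exact norm_indicator_mul_kernel_le N S t x

/-- On a cone `S` the scaling of the kernel moves the dependence on `t` into the exponential. -/
theorem continuousOn_partTransform {N : ℕ} (hN : 2 ≤ N) (hE : Even N) {S : Set ℝ}
    (hS : MeasurableSet S) (hcone : ∀ r x : ℝ, 0 < r → (r * x ∈ S ↔ x ∈ S)) (μ : ℝ) :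
    ContinuousOn (fun t => partTransform N S t μ) (Set.Ioi 0) := by
  have h : ∀ t ∈ Set.Ioi (0 : ℝ), partTransform N S t μ =
      ∫ x : ℝ, Complex.exp (Complex.I * μ * ((t ^ (1 / N : ℝ) * x : ℝ) : ℂ)) *
        ((S.indicator (fun _ => 1) x * (kernel N 1 x).re : ℝ) : ℂ) := by
    intro t ht
    have hr : 0 < t ^ (1 / N : ℝ) := Real.rpow_pos_of_pos ht _
    have h := Measure.integral_comp_mul_left (fun x : ℝ => Complex.exp (Complex.I * μ * x) *
      ((S.indicator (fun _ => 1) x * (kernel N t x).re : ℝ) : ℂ)) (t ^ (1 / N : ℝ))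
    rw [abs_of_pos (inv_pos.mpr hr), eq_inv_smul_iff₀ hr.ne', ← integral_smul] at h
    rw [partTransform, ← h]
    congr 1
    ext x
    have hi : S.indicator (fun _ => (1 : ℝ)) (t ^ (1 / N : ℝ) * x) =
        S.indicator (fun _ => (1 : ℝ)) x := by
      by_cases hx : x ∈ S
      · rw [Set.indicator_of_mem hx, Set.indicator_of_mem ((hcone _ x hr).mpr hx)]
      · rw [Set.indicator_of_notMem hx, Set.indicator_of_notMem fun h' => hx ((hcone _ x hr).mp h')]
    have hk : (kernel N t (t ^ (1 / N : ℝ) * x)).re =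
        (t ^ (1 / N : ℝ))⁻¹ * (kernel N 1 x).re := by
      rw [kernel_eq_scaled hN hE ht, inv_mul_cancel_left₀ hr.ne', Complex.re_ofReal_mul]
    have hr' : ((t ^ (1 / N : ℝ) : ℝ) : ℂ) ≠ 0 := by exact_mod_cast hr.ne'
    rw [hi, hk, Complex.real_smul]
    push_cast
    field_simp
  refine ContinuousOn.congr ?_ h
  refine continuousOn_of_dominated (bound := fun x => ‖kernel N 1 x‖) (fun t _ => ?_)
    (fun t _ => Eventually.of_forall fun x => ?_) (integrable_kernel hN hE one_pos).norm
    (Eventually.of_forall fun x => ?_)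
  · exact AEStronglyMeasurable.mul (by fun_prop)
      (integrable_indicator_mul_kernel hN hE hS one_pos).ofReal.aestronglyMeasurable
  · rw [norm_mul, norm_exp_I_mul, one_mul, Complex.norm_real]
    exact norm_indicator_mul_kernel_le N S 1 x
  · refine ContinuousOn.mul ?_ continuousOn_const
    have : ContinuousOn (fun t : ℝ => t ^ (1 / N : ℝ)) (Set.Ioi 0) := fun t ht =>
      (Real.continuousAt_rpow_const t _ (Or.inl (ne_of_gt ht))).continuousWithinAt
    fun_prop

/-! ### Characteristic functions of complex measures -/

/-- The characteristic functions of the finite complex measures carried by `S`, encoded through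
real and imaginary parts. -/
noncomputable def complexCharFun (S : Set ℝ) (hS : MeasurableSet S)
    (hadd : ∀ x ∈ S, ∀ y ∈ S, x + y ∈ S) : Submodule ℂ (ℝ → ℂ) where
  carrier := {f | ∃ f₁ ∈ signedCharFun S hS hadd, ∃ f₂ ∈ signedCharFun S hS hadd,
    f = f₁ + Complex.I • f₂}
  add_mem' := by
    rintro _ _ ⟨f₁, h₁, f₂, h₂, rfl⟩ ⟨g₁, k₁, g₂, k₂, rfl⟩
    exact ⟨f₁ + g₁, add_mem h₁ k₁, f₂ + g₂, add_mem h₂ k₂, by rw [smul_add]; abel⟩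
  zero_mem' := ⟨0, zero_mem _, 0, zero_mem _, by simp⟩
  smul_mem' := by
    rintro c _ ⟨f₁, h₁, f₂, h₂, rfl⟩
    refine ⟨c.re • f₁ - c.im • f₂, sub_mem ((signedCharFun S hS hadd).smul_mem _ h₁)
      ((signedCharFun S hS hadd).smul_mem _ h₂), c.re • f₂ + c.im • f₁,
      add_mem ((signedCharFun S hS hadd).smul_mem _ h₂)
        ((signedCharFun S hS hadd).smul_mem _ h₁), ?_⟩
    ext μ
    simp only [Pi.smul_apply, Pi.add_apply, Pi.sub_apply, smul_eq_mul, Complex.real_smul]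
    linear_combination (-(f₁ μ + Complex.I * f₂ μ)) * Complex.re_add_im c +
      (c.im : ℂ) * f₂ μ * Complex.I_sq

theorem signedCharFun_neg_arg {S : Set ℝ} {hS : MeasurableSet S}
    {hadd : ∀ x ∈ S, ∀ y ∈ S, x + y ∈ S} {f : ℝ → ℂ} (hf : f ∈ signedCharFun S hS hadd) (μ : ℝ) :
    f (-μ) = (starRingEnd ℂ) (f μ) := by
  obtain ⟨m₁, m₂, _, _, h₁, h₂, rfl⟩ := hf
  simp [charFun_neg]

theorem complexCharFun_disjoint {S T : Set ℝ} {hS : MeasurableSet S} {hT : MeasurableSet T}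
    {hSa : ∀ x ∈ S, ∀ y ∈ S, x + y ∈ S} {hTa : ∀ x ∈ T, ∀ y ∈ T, x + y ∈ T}
    (hST : Disjoint S T) {f : ℝ → ℂ} (hf : f ∈ complexCharFun S hS hSa)
    (hf' : f ∈ complexCharFun T hT hTa) : f = 0 := by
  obtain ⟨f₁, h₁, f₂, h₂, rfl⟩ := hf
  obtain ⟨g₁, k₁, g₂, k₂, h⟩ := hf'
  have hμ : ∀ μ, f₁ μ + Complex.I * f₂ μ = g₁ μ + Complex.I * g₂ μ := fun μ => congrFun h μ
  -- conjugation at `-μ` separates the real from the imaginary part of the measures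
  have hμ' : ∀ μ, f₁ μ - Complex.I * f₂ μ = g₁ μ - Complex.I * g₂ μ := by
    intro μ
    have := congrArg (starRingEnd ℂ) (hμ (-μ))
    simpa [signedCharFun_neg_arg h₁, signedCharFun_neg_arg h₂, signedCharFun_neg_arg k₁,
      signedCharFun_neg_arg k₂, sub_eq_add_neg] using this
  have e₁ : f₁ = g₁ := by
    ext μ
    linear_combination (1 / 2 : ℂ) * (hμ μ + hμ' μ)
  have e₂ : f₂ = g₂ := by
    ext μ
    linear_combination (-Complex.I / 2) * (hμ μ - hμ' μ) + (f₂ μ - g₂ μ) * Complex.I_sq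
  rw [signedCharFun_disjoint hST f₁ h₁ (e₁ ▸ k₁), signedCharFun_disjoint hST f₂ h₂ (e₂ ▸ k₂)]
  simp

theorem integral_exp_mem_complexCharFun {S : Set ℝ} {hS : MeasurableSet S}
    {hadd : ∀ x ∈ S, ∀ y ∈ S, x + y ∈ S} {Ω : Type*} [MeasurableSpace Ω] {P : Measure Ω}
    {g : Ω → ℂ} (hg : Measurable g) (hgi : Integrable g P) {X : Ω → ℝ} (hX : Measurable X)
    (hsupp : ∀ ω, g ω ≠ 0 → X ω ∈ S) :
    (fun μ : ℝ => ∫ ω, Complex.exp (Complex.I * μ * X ω) * g ω ∂P) ∈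
      complexCharFun S hS hadd := by
  have hre : Integrable (fun ω => (g ω).re) P := hgi.re
  have him : Integrable (fun ω => (g ω).im) P := hgi.im
  refine ⟨_, integral_exp_mem_signedCharFun (Complex.measurable_re.comp hg) hre hX
    (fun ω hω => hsupp ω fun h => hω (by simp [h])), _,
    integral_exp_mem_signedCharFun (Complex.measurable_im.comp hg) him hX
    (fun ω hω => hsupp ω fun h => hω (by simp [h])), ?_⟩
  ext μ
  have hb : ∀ h : Ω → ℝ, Integrable h P →
      Integrable (fun ω => Complex.exp (Complex.I * μ * X ω) * h ω) P := fun h hi =>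
    hi.ofReal.bdd_mul (c := 1) (by fun_prop) (Eventually.of_forall fun ω => (norm_exp_I_mul μ _).le)
  simp only [Pi.add_apply, Pi.smul_apply, smul_eq_mul, Function.comp_apply]
  rw [← integral_const_mul, ← integral_add (hb _ hre) ((hb _ him).const_mul _)]
  congr 1
  ext ω
  nth_rewrite 1 [← Complex.re_add_im (g ω)]
  ring

/-- The decomposition of a transform into parts carried by disjoint sets is unique. -/
theorem eq_of_add_eq_add {S T : Set ℝ} {hS : MeasurableSet S} {hT : MeasurableSet T}
    {hSa : ∀ x ∈ S, ∀ y ∈ S, x + y ∈ S} {hTa : ∀ x ∈ T, ∀ y ∈ T, x + y ∈ T}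
    (hST : Disjoint S T) {f f' g g' : ℝ → ℂ} (hf : f ∈ complexCharFun S hS hSa)
    (hf' : f' ∈ complexCharFun S hS hSa) (hg : g ∈ complexCharFun T hT hTa)
    (hg' : g' ∈ complexCharFun T hT hTa) (h : f + g = f' + g') : f = f' ∧ g = g' := by
  have e : f - f' = g' - g := by linear_combination h
  have z := complexCharFun_disjoint hST (sub_mem hf hf') (e ▸ sub_mem hg' hg)
  exact ⟨sub_eq_zero.mp z, (sub_eq_zero.mp (e ▸ z)).symm⟩

/-! ### The roots of `κ` -/

section Roots

open Polynomial

theorem kappa_ne_zero (N : ℕ) : kappa N ≠ 0 := pow_ne_zero _ (by norm_num)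

theorem kappa_mul_self (N : ℕ) : kappa N * kappa N = 1 := by
  rw [kappa, ← mul_pow]; norm_num

theorem kappa_mul_I_pow {N : ℕ} (hE : Even N) (μ : ℝ) :
    kappa N * (Complex.I * μ) ^ N = -((μ ^ N : ℝ) : ℂ) := by
  rw [← kappa_mul_pow hE, hE.neg_pow]

theorem prod_nthRoots {N : ℕ} (hN : 2 ≤ N) (X Y : ℂ) :
    ∏ θ ∈ nthRootsFinset N (kappa N), (X - Y * θ) = X ^ N - kappa N * Y ^ N := by
  classical
  have hN0 : N ≠ 0 := by omega
  have hnd : (nthRoots N (kappa N)).Nodup :=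
    nodup_roots (separable_X_pow_sub_C _ (by exact_mod_cast hN0) (kappa_ne_zero N))
  have hs := IsAlgClosed.splits (Polynomial.X ^ N - C (kappa N))
  have hprod := hs.eq_prod_roots_of_monic (monic_X_pow_sub_C _ hN0)
  have hcard : (nthRootsFinset N (kappa N)).card = N := by
    rw [nthRootsFinset_def, Multiset.toFinset_card_of_nodup hnd, nthRoots,
      ← hs.natDegree_eq_card_roots, natDegree_X_pow_sub_C]
  by_cases hY : Y = 0
  · simp [hY, hcard, hN0]
  · have h1 := congrArg (eval (X / Y)) hprod
    have h2 : ∏ θ ∈ nthRootsFinset N (kappa N), (X / Y - θ) = (X / Y) ^ N - kappa N := by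
      rw [Finset.prod, nthRootsFinset_def, Multiset.toFinset_val, hnd.dedup, nthRoots]
      simpa [eval_multiset_prod] using h1.symm
    have h3 : ∀ θ ∈ nthRootsFinset N (kappa N), X - Y * θ = Y * (X / Y - θ) := fun θ _ => by
      field_simp
    rw [Finset.prod_congr rfl h3, Finset.prod_mul_distrib, Finset.prod_const, hcard, h2, mul_sub,
      ← mul_pow, mul_div_cancel₀ _ hY]
    ring

theorem mem_rootsJ {N : ℕ} (hN : 2 ≤ N) {θ : ℂ} :
    θ ∈ rootsJ N ↔ θ ^ N = kappa N ∧ 0 < θ.re := by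
  classical
  rw [rootsJ, Finset.mem_filter, mem_nthRootsFinset (by omega)]

theorem mem_rootsK {N : ℕ} (hN : 2 ≤ N) {θ : ℂ} :
    θ ∈ rootsK N ↔ θ ^ N = kappa N ∧ θ.re < 0 := by
  classical
  rw [rootsK, Finset.mem_filter, mem_nthRootsFinset (by omega)]

/-- A purely imaginary `r` has `κ r ^ N = -(r / i) ^ N ≤ 0`, so that an `N`-th root of `κ s` is not
purely imaginary when `s` lies in the right half-plane. -/
theorem re_ne_zero_of_pow_eq {N : ℕ} (hE : Even N) {r s : ℂ} (hs : 0 < s.re)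
    (hr : r ^ N = kappa N * s) : r.re ≠ 0 := by
  intro h
  have h1 : r = Complex.I * (r.im : ℂ) := by
    apply Complex.ext <;> simp [h]
  have h2 := kappa_mul_I_pow hE r.im
  rw [← h1, hr, ← mul_assoc, kappa_mul_self, one_mul] at h2
  rw [h2, Complex.neg_re, Complex.ofReal_re] at hs
  linarith [hE.pow_nonneg r.im]

theorem disjoint_rootsJ_rootsK {N : ℕ} (hN : 2 ≤ N) : Disjoint (rootsJ N) (rootsK N) := by
  rw [Finset.disjoint_left]
  intro θ h1 h2
  linarith [((mem_rootsJ hN).mp h1).2, ((mem_rootsK hN).mp h2).2]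

theorem disjUnion_rootsJ_rootsK {N : ℕ} (hN : 2 ≤ N) (hE : Even N) :
    (rootsJ N).disjUnion (rootsK N) (disjoint_rootsJ_rootsK hN) =
      nthRootsFinset N (kappa N) := by
  ext θ
  rw [Finset.mem_disjUnion, mem_rootsJ hN, mem_rootsK hN, mem_nthRootsFinset (by omega)]
  refine ⟨fun h => h.elim And.left And.left, fun h => ?_⟩
  have := re_ne_zero_of_pow_eq hE (r := θ) (s := 1) (by simp) (by simpa using h)
  rcases lt_or_gt_of_ne this with h' | h'
  · exact Or.inr ⟨h, h'⟩
  · exact Or.inl ⟨h, h'⟩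

theorem prod_rootsJ_mul_prod_rootsK {N : ℕ} (hN : 2 ≤ N) (hE : Even N) (f : ℂ → ℂ) :
    (∏ θ ∈ rootsJ N, f θ) * ∏ θ ∈ rootsK N, f θ = ∏ θ ∈ nthRootsFinset N (kappa N), f θ := by
  rw [← disjUnion_rootsJ_rootsK hN hE, Finset.prod_disjUnion]

theorem sum_rootsJ_add_sum_rootsK {N : ℕ} (hN : 2 ≤ N) (hE : Even N) (f : ℂ → ℂ) :
    ∑ θ ∈ rootsJ N, f θ + ∑ θ ∈ rootsK N, f θ = ∑ θ ∈ nthRootsFinset N (kappa N), f θ := by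
  rw [← disjUnion_rootsJ_rootsK hN hE, Finset.sum_disjUnion]

theorem root_pow {N : ℕ} (hN : 2 ≤ N) (s : ℂ) : (s ^ (1 / (N : ℂ))) ^ N = s := by
  rw [one_div]
  exact Complex.cpow_nat_inv_pow s (by omega)

/-- Multiplication of a root of `κ` by the principal `N`-th root of a point of the right half-plane
keeps it in the right half-plane: the product never meets the imaginary axis. -/
theorem re_mul_root_pos {N : ℕ} (hN : 2 ≤ N) (hE : Even N) {θ s : ℂ} (hθ : θ ^ N = kappa N)
    (hre : 0 < θ.re) (hs : 0 < s.re) : 0 < (θ * s ^ (1 / (N : ℂ))).re := by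
  by_contra hneg
  have hpre : IsPreconnected {s : ℂ | 0 < s.re} :=
    (convex_halfSpace_re_gt 0).isPreconnected
  have hcont : ContinuousOn (fun s : ℂ => (θ * s ^ (1 / (N : ℂ))).re) {s : ℂ | 0 < s.re} := by
    intro s hs
    refine ContinuousAt.continuousWithinAt (Complex.continuous_re.continuousAt.comp
      (continuousAt_const.mul ?_))
    exact continuousAt_id.cpow continuousAt_const (Or.inl hs)
  have h1 : (0 : ℝ) < (θ * (1 : ℂ) ^ (1 / (N : ℂ))).re := by simpa using hre
  obtain ⟨r, hr, h0⟩ := hpre.intermediate_value hs (show (1 : ℂ) ∈ {s : ℂ | 0 < s.re} by simp)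
    hcont ⟨not_lt.mp hneg, h1.le⟩
  exact re_ne_zero_of_pow_eq hE hr (by rw [mul_pow, hθ, root_pow hN]) h0

theorem re_root_div_pos {N : ℕ} (hN : 2 ≤ N) (hE : Even N) {θ s : ℂ} (hθ : θ ^ N = kappa N)
    (hre : 0 < θ.re) (hs : 0 < s.re) : 0 < (s ^ (1 / (N : ℂ)) / θ).re := by
  have hθ0 : θ ≠ 0 := fun h => by simp [h] at hre
  rw [div_eq_mul_inv, mul_comm]
  refine re_mul_root_pos hN hE ?_ ?_ hs
  · rw [inv_pow, hθ]
    exact inv_eq_of_mul_eq_one_left (kappa_mul_self N)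
  · rw [Complex.inv_re]
    exact div_pos hre (Complex.normSq_pos.mpr hθ0)

theorem re_root_div_neg {N : ℕ} (hN : 2 ≤ N) (hE : Even N) {θ s : ℂ} (hθ : θ ^ N = kappa N)
    (hre : θ.re < 0) (hs : 0 < s.re) : 0 < (-(s ^ (1 / (N : ℂ)) / θ)).re := by
  rw [← div_neg]
  exact re_root_div_pos hN hE (by rw [hE.neg_pow, hθ]) (by simpa using hre) hs

theorem hasDerivAt_prod_sub {𝕜 ι : Type*} [NontriviallyNormedField 𝕜] [NormedAlgebra 𝕜 ℂ]
    {F : 𝕜 → ℂ} {F' : ℂ} {x : 𝕜} (hF : HasDerivAt F F' x) (s : Finset ι) (c : ι → ℂ)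
    (hc : ∀ i ∈ s, F x - c i ≠ 0) :
    HasDerivAt (fun y => ∏ i ∈ s, (F y - c i))
      ((∏ i ∈ s, (F x - c i)) * ∑ i ∈ s, F' / (F x - c i)) x := by
  classical
  refine (HasDerivAt.fun_finsetProd fun i _ => hF.sub_const (c i)).congr_deriv ?_
  rw [Finset.mul_sum]
  refine Finset.sum_congr rfl fun i hi => ?_
  rw [← Finset.mul_prod_erase s _ hi, smul_eq_mul]
  have := hc i hi
  field_simp

theorem add_pow_ne_zero {N : ℕ} (hE : Even N) {s : ℂ} (hs : 0 < s.re) (μ : ℝ) :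
    s + (μ ^ N : ℝ) ≠ 0 := by
  intro h
  have := congrArg Complex.re h
  simp only [Complex.add_re, Complex.ofReal_re, Complex.zero_re] at this
  linarith [hE.pow_nonneg μ]

theorem prod_root_sub {N : ℕ} (hN : 2 ≤ N) (hE : Even N) (s : ℂ) (μ : ℝ) :
    ∏ θ ∈ nthRootsFinset N (kappa N), (s ^ (1 / (N : ℂ)) - Complex.I * μ * θ) =
      s + (μ ^ N : ℝ) := by
  rw [prod_nthRoots hN, root_pow hN, kappa_mul_I_pow hE]
  ring

theorem root_sub_ne_zero {N : ℕ} (hN : 2 ≤ N) (hE : Even N) {s : ℂ} (hs : 0 < s.re) (μ : ℝ)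
    {θ : ℂ} (hθ : θ ^ N = kappa N) : s ^ (1 / (N : ℂ)) - Complex.I * μ * θ ≠ 0 := by
  have h := add_pow_ne_zero hE hs μ
  rw [← prod_root_sub hN hE, Finset.prod_ne_zero_iff] at h
  exact h θ ((mem_nthRootsFinset (by omega) _).mpr hθ)

/-- Partial fractions of `1 / (s + μ ^ N)`, from the logarithmic derivative of
`X ^ N - κ (i μ) ^ N` at `X = s ^ (1 / N)`. -/
theorem sum_partial_fractions {N : ℕ} (hN : 2 ≤ N) (hE : Even N) {s : ℂ} (hs : 0 < s.re) (μ : ℝ) :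
    ∑ θ ∈ nthRootsFinset N (kappa N),
      s ^ (1 / (N : ℂ)) / (s * N * (s ^ (1 / (N : ℂ)) - Complex.I * μ * θ)) =
      1 / (s + (μ ^ N : ℝ)) := by
  set S := s ^ (1 / (N : ℂ)) with hS
  have hs0 : s ≠ 0 := fun h => by simp [h] at hs
  have hN0 : (N : ℂ) ≠ 0 := by exact_mod_cast (by omega : N ≠ 0)
  have hne := add_pow_ne_zero hE hs μ
  have hd := hasDerivAt_prod_sub (hasDerivAt_id S) (nthRootsFinset N (kappa N))
    (fun θ => Complex.I * μ * θ) fun θ hθ =>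
      root_sub_ne_zero hN hE hs μ ((mem_nthRootsFinset (by omega) _).mp hθ)
  have hd' : HasDerivAt (fun X : ℂ => X ^ N - kappa N * (Complex.I * μ) ^ N)
      (N * S ^ (N - 1)) S := (hasDerivAt_pow N S).sub_const _
  simp only [id] at hd
  simp only [prod_nthRoots hN] at hd
  have e := hd.unique hd'
  rw [root_pow hN, kappa_mul_I_pow hE, sub_neg_eq_add] at e
  have hSN : S ^ (N - 1) * S = s := by rw [pow_sub_one_mul (by omega), root_pow hN]
  have e2 : ∑ θ ∈ nthRootsFinset N (kappa N), S / (s * N * (S - Complex.I * μ * θ)) =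
      S / (s * N) * ∑ θ ∈ nthRootsFinset N (kappa N), 1 / (S - Complex.I * μ * θ) := by
    rw [Finset.mul_sum]
    refine Finset.sum_congr rfl fun θ _ => ?_
    rw [div_mul_div_comm, mul_one]
  rw [e2, eq_div_iff hne]
  field_simp
  field_simp at e
  linear_combination S * e + N * hSN

end Roots

/-! ### The Laplace transform in time -/

/-- Joint measurability needs no integrability: parametric Bochner integrals of measurable functions
are measurable, also at the times `t ≤ 0` where the integral has a junk value. -/
theorem measurable_kernel_uncurry (N : ℕ) : Measurable fun p : ℝ × ℝ => kernel N p.1 p.2 := by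
  have hc : Continuous fun q : (ℝ × ℝ) × ℝ => Complex.exp (-(Complex.I * q.2 * q.1.2)) *
      Complex.exp (kappa N * q.1.1 * (-(Complex.I * q.2)) ^ N) := by fun_prop
  have h := hc.stronglyMeasurable.integral_prod_right' (ν := (volume : Measure ℝ))
  exact measurable_const.mul h.measurable

/-- The Laplace transform in time of `partTransform`. -/
noncomputable def partLaplace (N : ℕ) (S : Set ℝ) (s : ℂ) (μ : ℝ) : ℂ :=
  ∫ t in Set.Ioi (0 : ℝ), Complex.exp (-(s * t)) * partTransform N S t μ

theorem norm_exp_neg_mul (s : ℂ) (t : ℝ) :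
    ‖Complex.exp (-(s * t))‖ = Real.exp (-s.re * t) := by
  rw [Complex.norm_exp]
  simp

theorem integrableOn_exp_neg_mul {s : ℂ} (hs : 0 < s.re) :
    IntegrableOn (fun t : ℝ => Complex.exp (-(s * t))) (Set.Ioi 0) := by
  have := integrableOn_exp_mul_complex_Ioi (a := -s) (by simpa using hs) 0
  simpa using this

theorem measurable_laplace_density (N : ℕ) {S : Set ℝ} (hS : MeasurableSet S) (s : ℂ) :
    Measurable fun p : ℝ × ℝ => Complex.exp (-(s * p.1)) *
      ((S.indicator (fun _ => 1) p.2 * (kernel N p.1 p.2).re : ℝ) : ℂ) := by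
  have h1 := measurable_kernel_uncurry N
  have h2 : Measurable fun p : ℝ × ℝ => S.indicator (fun _ => (1 : ℝ)) p.2 :=
    (measurable_const.indicator hS).comp measurable_snd
  exact (by fun_prop : Measurable fun p : ℝ × ℝ => Complex.exp (-(s * p.1))).mul
    (Complex.measurable_ofReal.comp (h2.mul (Complex.measurable_re.comp h1)))

theorem integrable_laplace_density {N : ℕ} (hN : 2 ≤ N) (hE : Even N) {S : Set ℝ}
    (hS : MeasurableSet S) {s : ℂ} (hs : 0 < s.re) :
    Integrable (fun p : ℝ × ℝ => Complex.exp (-(s * p.1)) *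
      ((S.indicator (fun _ => 1) p.2 * (kernel N p.1 p.2).re : ℝ) : ℂ))
      ((volume.restrict (Set.Ioi 0)).prod volume) := by
  have hm := measurable_laplace_density N hS s
  refine (integrable_prod_iff hm.aestronglyMeasurable).mpr ⟨?_, ?_⟩
  · filter_upwards [ae_restrict_mem measurableSet_Ioi] with t ht
    exact (integrable_indicator_mul_kernel hN hE hS ht).ofReal.const_mul _
  · refine ((integrableOn_exp_neg_mul hs).norm.mul_const (∫ x, ‖kernel N 1 x‖)).mono'
      hm.norm.stronglyMeasurable.integral_prod_right'.aestronglyMeasurable ?_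
    filter_upwards [ae_restrict_mem measurableSet_Ioi] with t ht
    rw [Real.norm_of_nonneg (integral_nonneg fun _ => norm_nonneg _)]
    simp only [norm_mul, Complex.norm_real]
    rw [integral_const_mul, ← integral_norm_kernel hN hE ht]
    refine mul_le_mul_of_nonneg_left (integral_mono ?_ (integrable_kernel hN hE ht).norm
      fun x => ?_) (norm_nonneg _)
    · simpa only [norm_mul] using (integrable_indicator_mul_kernel hN hE hS ht).norm
    · simpa only [norm_mul] using norm_indicator_mul_kernel_le N S t x

theorem partLaplace_mem {N : ℕ} (hN : 2 ≤ N) (hE : Even N) {S : Set ℝ} (hS : MeasurableSet S)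
    (hadd : ∀ x ∈ S, ∀ y ∈ S, x + y ∈ S) {s : ℂ} (hs : 0 < s.re) :
    partLaplace N S s ∈ complexCharFun S hS hadd := by
  have h := integral_exp_mem_complexCharFun (hS := hS) (hadd := hadd)
    (measurable_laplace_density N hS s) (integrable_laplace_density hN hE hS hs) measurable_snd
    (fun p hp => by
      by_contra hx
      exact hp (by simp [show p.2 ∉ S from hx]))
  convert h using 1
  ext μ
  have hi : Integrable (fun p : ℝ × ℝ => Complex.exp (Complex.I * μ * p.2) *
      (Complex.exp (-(s * p.1)) * ((S.indicator (fun _ => 1) p.2 * (kernel N p.1 p.2).re : ℝ) : ℂ)))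
      ((volume.restrict (Set.Ioi 0)).prod volume) :=
    (integrable_laplace_density hN hE hS hs).bdd_mul (c := 1) (by fun_prop)
      (Eventually.of_forall fun p => (norm_exp_I_mul μ _).le)
  rw [integral_prod _ hi, partLaplace]
  congr 1
  ext t
  rw [partTransform, ← integral_const_mul]
  congr 1
  ext x
  ring

theorem aestronglyMeasurable_partTransform {N : ℕ} (hN : 2 ≤ N) (hE : Even N) {S : Set ℝ}
    (hS : MeasurableSet S) (hcone : ∀ r x : ℝ, 0 < r → (r * x ∈ S ↔ x ∈ S)) (μ : ℝ) :
    AEStronglyMeasurable (fun t => partTransform N S t μ) (volume.restrict (Set.Ioi 0)) :=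
  (continuousOn_partTransform hN hE hS hcone μ).aestronglyMeasurable measurableSet_Ioi

theorem mul_mem_Ici_iff (r x : ℝ) (hr : 0 < r) : r * x ∈ Set.Ici (0 : ℝ) ↔ x ∈ Set.Ici (0 : ℝ) := by
  simp [hr]

theorem mul_mem_Iio_iff (r x : ℝ) (hr : 0 < r) : r * x ∈ Set.Iio (0 : ℝ) ↔ x ∈ Set.Iio (0 : ℝ) := by
  simp [mul_neg_iff, hr, hr.not_gt]

theorem add_mem_Ici_zero : ∀ x ∈ Set.Ici (0 : ℝ), ∀ y ∈ Set.Ici (0 : ℝ), x + y ∈ Set.Ici (0 : ℝ) :=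
  fun _ hx _ hy => add_nonneg (Set.mem_Ici.mp hx) (Set.mem_Ici.mp hy)

theorem add_mem_Iio_zero : ∀ x ∈ Set.Iio (0 : ℝ), ∀ y ∈ Set.Iio (0 : ℝ), x + y ∈ Set.Iio (0 : ℝ) :=
  fun _ hx _ hy => add_neg (Set.mem_Iio.mp hx) (Set.mem_Iio.mp hy)

theorem disjoint_Ici_Iio : Disjoint (Set.Ici (0 : ℝ)) (Set.Iio 0) :=
  Set.disjoint_left.mpr fun _ h1 h2 => not_lt.mpr (Set.mem_Ici.mp h1) (Set.mem_Iio.mp h2)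

theorem integrableOn_exp_mul_partTransform {N : ℕ} (hN : 2 ≤ N) (hE : Even N) {S : Set ℝ}
    (hS : MeasurableSet S) (hcone : ∀ r x : ℝ, 0 < r → (r * x ∈ S ↔ x ∈ S)) {s : ℂ}
    (hs : 0 < s.re) (μ : ℝ) :
    IntegrableOn (fun t : ℝ => Complex.exp (-(s * t)) * partTransform N S t μ) (Set.Ioi 0) :=
  Integrable.mul_bdd (c := ∫ x, ‖kernel N 1 x‖) (integrableOn_exp_neg_mul hs)
    (aestronglyMeasurable_partTransform hN hE hS hcone μ)
    (by filter_upwards [ae_restrict_mem measurableSet_Ioi] with t ht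
        exact norm_partTransform_le hN hE S ht μ)

theorem partLaplace_add {N : ℕ} (hN : 2 ≤ N) (hE : Even N) {s : ℂ} (hs : 0 < s.re) (μ : ℝ) :
    partLaplace N (Set.Ici 0) s μ + partLaplace N (Set.Iio 0) s μ = 1 / (s + (μ ^ N : ℝ)) := by
  have hre : 0 < (s + (μ ^ N : ℝ)).re := by
    rw [Complex.add_re, Complex.ofReal_re]
    linarith [hE.pow_nonneg μ]
  have h := integral_exp_mul_complex_Ioi (a := -(s + (μ ^ N : ℝ))) (by rw [Complex.neg_re]; linarith) 0
  rw [Complex.ofReal_zero, mul_zero, Complex.exp_zero, neg_div_neg_eq] at h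
  rw [partLaplace, partLaplace, ← integral_add
    (integrableOn_exp_mul_partTransform hN hE measurableSet_Ici mul_mem_Ici_iff hs μ)
    (integrableOn_exp_mul_partTransform hN hE measurableSet_Iio mul_mem_Iio_iff hs μ), ← h]
  refine setIntegral_congr_fun measurableSet_Ioi fun t ht => ?_
  rw [← mul_add, partTransform_add hN hE ht, symbol, Complex.ofReal_exp, ← Complex.exp_add]
  congr 1
  push_cast
  ring

/-! ### Exponential densities -/

theorem inv_sub_mem_complexCharFun {a : ℂ} (ha : 0 < a.re) :
    (fun μ : ℝ => 1 / (a - Complex.I * μ)) ∈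
      complexCharFun (Set.Ici 0) measurableSet_Ici add_mem_Ici_zero := by
  have hi : Integrable ((Set.Ici (0 : ℝ)).indicator fun x : ℝ => Complex.exp (-a * x)) := by
    rw [integrable_indicator_iff measurableSet_Ici, integrableOn_Ici_iff_integrableOn_Ioi]
    exact integrableOn_exp_mul_complex_Ioi (by simpa using ha) 0
  have h := integral_exp_mem_complexCharFun (hS := measurableSet_Ici) (hadd := add_mem_Ici_zero)
    ((by fun_prop : Measurable fun x : ℝ => Complex.exp (-a * x)).indicator measurableSet_Ici)
    hi measurable_id fun x hx => by
      by_contra h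
      exact hx (Set.indicator_of_notMem h _)
  convert h using 1
  ext μ
  have h2 := integral_exp_mul_complex_Ioi (a := -(a - Complex.I * μ)) (by simpa using ha) 0
  rw [Complex.ofReal_zero, mul_zero, Complex.exp_zero, neg_div_neg_eq] at h2
  rw [← h2, ← integral_Ici_eq_integral_Ioi, ← integral_indicator measurableSet_Ici]
  congr 1
  ext x
  simp only [Set.indicator_apply, id]
  split_ifs
  · rw [← Complex.exp_add]
    congr 1
    ring
  · rw [mul_zero]

theorem inv_add_mem_complexCharFun {a : ℂ} (ha : 0 < a.re) :
    (fun μ : ℝ => 1 / (a + Complex.I * μ)) ∈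
      complexCharFun (Set.Iio 0) measurableSet_Iio add_mem_Iio_zero := by
  have hi : Integrable ((Set.Iio (0 : ℝ)).indicator fun x : ℝ => Complex.exp (a * x)) := by
    rw [integrable_indicator_iff measurableSet_Iio, ← integrableOn_Iic_iff_integrableOn_Iio]
    exact integrableOn_exp_mul_complex_Iic ha 0
  have h := integral_exp_mem_complexCharFun (hS := measurableSet_Iio) (hadd := add_mem_Iio_zero)
    ((by fun_prop : Measurable fun x : ℝ => Complex.exp (a * x)).indicator measurableSet_Iio)
    hi measurable_id fun x hx => by
      by_contra h
      exact hx (Set.indicator_of_notMem h _)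
  convert h using 1
  ext μ
  have h2 := integral_exp_mul_complex_Iic (a := a + Complex.I * μ) (by simpa using ha) 0
  rw [Complex.ofReal_zero, mul_zero, Complex.exp_zero] at h2
  rw [← h2, integral_Iic_eq_integral_Iio, ← integral_indicator measurableSet_Iio]
  congr 1
  ext x
  simp only [Set.indicator_apply, id]
  split_ifs
  · rw [← Complex.exp_add]
    congr 1
    ring
  · rw [mul_zero]

/-- The Laplace transforms of the two parts of the kernel. The partial fractions of
`1 / (s + μ ^ N)` with poles in the two half-planes are transforms of measures on the two
half-lines, hence coincide with the two parts. -/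
theorem partLaplace_eq {N : ℕ} (hN : 2 ≤ N) (hE : Even N) {s : ℂ} (hs : 0 < s.re) (μ : ℝ) :
    partLaplace N (Set.Ici 0) s μ = ∑ θ ∈ rootsJ N,
        s ^ (1 / (N : ℂ)) / (s * N * (s ^ (1 / (N : ℂ)) - Complex.I * μ * θ)) ∧
      partLaplace N (Set.Iio 0) s μ = ∑ θ ∈ rootsK N,
        s ^ (1 / (N : ℂ)) / (s * N * (s ^ (1 / (N : ℂ)) - Complex.I * μ * θ)) := by
  set S := s ^ (1 / (N : ℂ)) with hS
  have hs0 : s ≠ 0 := fun h => by simp [h] at hs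
  have hN0 : (N : ℂ) ≠ 0 := by exact_mod_cast (by omega : N ≠ 0)
  have hJ : (fun μ : ℝ => ∑ θ ∈ rootsJ N, S / (s * N * (S - Complex.I * μ * θ))) ∈
      complexCharFun (Set.Ici 0) measurableSet_Ici add_mem_Ici_zero := by
    have : (fun μ : ℝ => ∑ θ ∈ rootsJ N, S / (s * N * (S - Complex.I * μ * θ))) =
        ∑ θ ∈ rootsJ N, (S / (s * N * θ)) • fun μ : ℝ => 1 / (S / θ - Complex.I * μ) := by
      ext μ
      simp only [Finset.sum_apply, Pi.smul_apply, smul_eq_mul]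
      refine Finset.sum_congr rfl fun θ hθ => ?_
      have h0 : θ ≠ 0 := fun h => by simpa [h] using ((mem_rootsJ hN).mp hθ).2
      rw [div_mul_div_comm, mul_one, mul_assoc (s * (N : ℂ)) θ, mul_sub θ, mul_div_cancel₀ _ h0,
        mul_comm θ]
    rw [this]
    refine sum_mem fun θ hθ => Submodule.smul_mem _ _ (inv_sub_mem_complexCharFun ?_)
    obtain ⟨h1, h2⟩ := (mem_rootsJ hN).mp hθ
    exact re_root_div_pos hN hE h1 h2 hs
  have hK : (fun μ : ℝ => ∑ θ ∈ rootsK N, S / (s * N * (S - Complex.I * μ * θ))) ∈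
      complexCharFun (Set.Iio 0) measurableSet_Iio add_mem_Iio_zero := by
    have : (fun μ : ℝ => ∑ θ ∈ rootsK N, S / (s * N * (S - Complex.I * μ * θ))) =
        ∑ θ ∈ rootsK N, (-S / (s * N * θ)) • fun μ : ℝ => 1 / (-(S / θ) + Complex.I * μ) := by
      ext μ
      simp only [Finset.sum_apply, Pi.smul_apply, smul_eq_mul]
      refine Finset.sum_congr rfl fun θ hθ => ?_
      have h0 : θ ≠ 0 := fun h => by simpa [h] using ((mem_rootsK hN).mp hθ).2
      rw [div_mul_div_comm, mul_one, mul_assoc (s * (N : ℂ)) θ, mul_add θ, mul_neg θ,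
        mul_div_cancel₀ _ h0, ← neg_div_neg_eq]
      congr 1
      ring
    rw [this]
    refine sum_mem fun θ hθ => Submodule.smul_mem _ _ (inv_add_mem_complexCharFun ?_)
    obtain ⟨h1, h2⟩ := (mem_rootsK hN).mp hθ
    exact re_root_div_neg hN hE h1 h2 hs
  obtain ⟨e1, e2⟩ := eq_of_add_eq_add disjoint_Ici_Iio
    (partLaplace_mem hN hE measurableSet_Ici add_mem_Ici_zero hs) hJ
    (partLaplace_mem hN hE measurableSet_Iio add_mem_Iio_zero hs) hK (by
      ext μ
      rw [Pi.add_apply, Pi.add_apply, partLaplace_add hN hE hs, sum_rootsJ_add_sum_rootsK hN hE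
        (fun θ => S / (s * N * (S - Complex.I * μ * θ))), sum_partial_fractions hN hE hs])
  exact ⟨congrFun e1 μ, congrFun e2 μ⟩

/-! ### The exponent in the continuous-time limit -/

theorem exponentFactor_nonneg {r t : ℝ} (hr : 0 ≤ r) (ht : 0 < t) :
    0 ≤ (1 - Real.exp (-(r * t))) / t :=
  div_nonneg (sub_nonneg.mpr (Real.exp_le_one_iff.mpr (by nlinarith))) ht.le

theorem exponentFactor_le (r : ℝ) {t : ℝ} (ht : 0 < t) :
    (1 - Real.exp (-(r * t))) / t ≤ r := by
  rw [div_le_iff₀ ht]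
  linarith [Real.add_one_le_exp (-(r * t))]

/-- The integrand of `spitzerExponent`. -/
noncomputable def exponentDensity (N : ℕ) (S : Set ℝ) (lam : ℂ) (μ r t : ℝ) : ℂ :=
  Complex.exp (-(lam * t)) * (((1 - Real.exp (-(r * t))) / t : ℝ) : ℂ) * partTransform N S t μ

/-- The continuous-time analogue of the exponent in Spitzer's identity. -/
noncomputable def spitzerExponent (N : ℕ) (S : Set ℝ) (lam : ℂ) (μ r : ℝ) : ℂ :=
  ∫ t in Set.Ioi (0 : ℝ), exponentDensity N S lam μ r t

theorem norm_exponentDensity_le {N : ℕ} (hN : 2 ≤ N) (hE : Even N) (S : Set ℝ) (lam : ℂ) (μ : ℝ)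
    {r t : ℝ} (hr : 0 ≤ r) (ht : 0 < t) :
    ‖exponentDensity N S lam μ r t‖ ≤
      (r * ∫ x, ‖kernel N 1 x‖) * Real.exp (-lam.re * t) := by
  rw [exponentDensity, norm_mul, norm_mul, norm_exp_neg_mul, Complex.norm_real,
    Real.norm_of_nonneg (exponentFactor_nonneg hr ht)]
  have h1 := exponentFactor_le r ht
  have h2 := norm_partTransform_le hN hE S ht μ
  calc _ ≤ Real.exp (-lam.re * t) * r * ∫ x, ‖kernel N 1 x‖ := by gcongr
    _ = _ := by ring

theorem continuousOn_exponentDensity {N : ℕ} (hN : 2 ≤ N) (hE : Even N) {S : Set ℝ}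
    (hS : MeasurableSet S) (hcone : ∀ r x : ℝ, 0 < r → (r * x ∈ S ↔ x ∈ S)) (lam : ℂ) (μ r : ℝ) :
    ContinuousOn (exponentDensity N S lam μ r) (Set.Ioi 0) := by
  have h1 := continuousOn_partTransform hN hE hS hcone μ
  have h2 : ContinuousOn (fun t : ℝ => (1 - Real.exp (-(r * t))) / t) (Set.Ioi 0) :=
    ContinuousOn.div (by fun_prop) continuousOn_id fun t ht => ne_of_gt ht
  unfold exponentDensity
  exact (ContinuousOn.mul (by fun_prop) (Complex.continuous_ofReal.comp_continuousOn h2)).mul h1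

theorem hasDerivAt_spitzerExponent {N : ℕ} (hN : 2 ≤ N) (hE : Even N) {S : Set ℝ}
    (hS : MeasurableSet S) (hcone : ∀ r x : ℝ, 0 < r → (r * x ∈ S ↔ x ∈ S)) {lam : ℂ}
    (hlam : 0 < lam.re) (μ : ℝ) {r : ℝ} (hr : 0 ≤ r) :
    HasDerivAt (spitzerExponent N S lam μ) (partLaplace N S (lam + r) μ) r := by
  have hmeas : ∀ q, AEStronglyMeasurable (exponentDensity N S lam μ q)
      (volume.restrict (Set.Ioi 0)) := fun q =>
    (continuousOn_exponentDensity hN hE hS hcone lam μ q).aestronglyMeasurable measurableSet_Ioi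
  refine (hasDerivAt_integral_of_dominated_loc_of_deriv_le (μ := volume.restrict (Set.Ioi 0))
    (s := Set.Ioi (-(lam.re / 2)))
    (F := exponentDensity N S lam μ)
    (F' := fun q t => Complex.exp (-((lam + q) * t)) * partTransform N S t μ)
    (bound := fun t => Real.exp (-(lam.re / 2) * t) * ∫ x, ‖kernel N 1 x‖)
    (Ioi_mem_nhds (by linarith)) (Eventually.of_forall hmeas) ?_ ?_ ?_ ?_ ?_).2
  · refine ((exp_neg_integrableOn_Ioi 0 hlam).const_mul
      (r * ∫ x, ‖kernel N 1 x‖)).mono' (hmeas r) ?_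
    filter_upwards [ae_restrict_mem measurableSet_Ioi] with t ht
    exact norm_exponentDensity_le hN hE S lam μ hr ht
  · exact AEStronglyMeasurable.mul (by fun_prop)
      (aestronglyMeasurable_partTransform hN hE hS hcone μ)
  · filter_upwards [ae_restrict_mem measurableSet_Ioi] with t ht q hq
    rw [norm_mul, norm_exp_neg_mul]
    refine mul_le_mul (Real.exp_le_exp.mpr ?_) (norm_partTransform_le hN hE S ht μ)
      (norm_nonneg _) (Real.exp_pos _).le
    have h1 : -(lam.re / 2) < q := hq
    have h2 : (0 : ℝ) < t := ht
    rw [Complex.add_re, Complex.ofReal_re]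
    nlinarith
  · exact (exp_neg_integrableOn_Ioi 0 (half_pos hlam)).mul_const _
  · filter_upwards [ae_restrict_mem measurableSet_Ioi] with t ht q _
    have ht0 : t ≠ 0 := ne_of_gt ht
    have h1 : HasDerivAt (fun q : ℝ => (1 - Real.exp (-(q * t))) / t) (Real.exp (-(q * t))) q := by
      have h0 : HasDerivAt (fun q : ℝ => -(q * t)) (-t) q := by
        simpa using ((hasDerivAt_id q).mul_const t).fun_neg
      refine ((h0.exp.const_sub 1).div_const t).congr_deriv ?_
      field_simp
    refine ((h1.ofReal_comp.const_mul (Complex.exp (-(lam * t)))).mul_const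
      (partTransform N S t μ)).congr_deriv ?_
    rw [Complex.ofReal_exp, ← Complex.exp_add]
    congr 2
    push_cast
    ring

theorem spitzerExponent_zero (N : ℕ) (S : Set ℝ) (lam : ℂ) (μ : ℝ) :
    spitzerExponent N S lam μ 0 = 0 := by
  simp [spitzerExponent, exponentDensity]

theorem hasDerivAt_root {N : ℕ} {lam : ℂ} (hlam : 0 < lam.re) {r : ℝ}
    (hr : 0 ≤ r) : HasDerivAt (fun q : ℝ => (lam + q) ^ (1 / (N : ℂ)))
      ((lam + r) ^ (1 / (N : ℂ)) / ((lam + r) * N)) r := by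
  have hre : 0 < (lam + r).re := by
    rw [Complex.add_re, Complex.ofReal_re]; linarith
  have h0 : lam + r ≠ 0 := fun h => by rw [h] at hre; simp at hre
  have h := (((hasDerivAt_id (r : ℂ)).const_add lam).cpow_const (c := 1 / (N : ℂ))
    (Or.inl hre)).comp_ofReal
  refine h.congr_deriv ?_
  simp only [id]
  rw [Complex.cpow_sub _ _ h0, Complex.cpow_one, mul_one, div_mul_div_comm, one_mul, mul_comm (N : ℂ)]

/-- The exponential of the limiting exponent as a product over roots: both sides have the same
logarithmic derivative in `ν`, which is the Laplace transform of the part of the kernel. -/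
theorem exp_spitzerExponent {N : ℕ} (hN : 2 ≤ N) (hE : Even N) {S : Set ℝ}
    (hS : MeasurableSet S) (hcone : ∀ r x : ℝ, 0 < r → (r * x ∈ S ↔ x ∈ S)) {lam : ℂ}
    (hlam : 0 < lam.re) (μ : ℝ) {ν : ℝ} (hν : 0 ≤ ν) {T : Finset ℂ}
    (hT : ∀ θ ∈ T, θ ^ N = kappa N)
    (hL : ∀ s : ℂ, 0 < s.re → partLaplace N S s μ = ∑ θ ∈ T,
      s ^ (1 / (N : ℂ)) / (s * N * (s ^ (1 / (N : ℂ)) - Complex.I * μ * θ))) :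
    Complex.exp (spitzerExponent N S lam μ ν) *
        ∏ θ ∈ T, (lam ^ (1 / (N : ℂ)) - Complex.I * μ * θ) =
      ∏ θ ∈ T, ((lam + ν) ^ (1 / (N : ℂ)) - Complex.I * μ * θ) := by
  set H : ℝ → ℂ := fun r => Complex.exp (-spitzerExponent N S lam μ r) *
    ∏ θ ∈ T, ((lam + r) ^ (1 / (N : ℂ)) - Complex.I * μ * θ) with hH
  have hd : ∀ r : ℝ, 0 ≤ r → HasDerivAt H 0 r := by
    intro r hr
    have hre : 0 < (lam + r).re := by
      rw [Complex.add_re, Complex.ofReal_re]; linarith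
    have h1 := (hasDerivAt_spitzerExponent hN hE hS hcone hlam μ hr).neg.cexp
    have h2 := hasDerivAt_prod_sub (hasDerivAt_root (N := N) hlam hr) T
      (fun θ => Complex.I * μ * θ) fun θ hθ => root_sub_ne_zero hN hE hre μ (hT θ hθ)
    refine (h1.mul h2).congr_deriv ?_
    rw [hL _ hre]
    simp only [div_div]
    ring
  have hc := constant_of_has_deriv_right_zero (f := H) (a := 0) (b := ν)
    (fun r hr => (hd r hr.1).continuousAt.continuousWithinAt)
    (fun r hr => (hd r hr.1).hasDerivWithinAt) ν ⟨hν, le_rfl⟩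
  simp only [hH, spitzerExponent_zero, neg_zero, Complex.exp_zero, one_mul, Complex.ofReal_zero,
    add_zero] at hc
  rw [← hc, ← mul_assoc, ← Complex.exp_add, add_neg_cancel, Complex.exp_zero, one_mul]

/-! ### Riemann sums -/

/-- Right Riemann sums on the half-line, under an exponential bound: they are integrals of the step
functions `f (⌈2 ^ n t⌉ / 2 ^ n)`, dominated since rounding up only decreases the bound. -/
theorem tendsto_riemann_sum {f : ℝ → ℂ} (hf : ContinuousOn f (Set.Ioi 0)) {C c : ℝ} (hc : 0 < c)
    (hb : ∀ t, 0 < t → ‖f t‖ ≤ C * Real.exp (-c * t)) :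
    Tendsto (fun n : ℕ => ∑' k : ℕ, ((1 / 2 ^ n : ℝ) : ℂ) * f (((k : ℝ) + 1) * (1 / 2 ^ n))) atTop
      (𝓝 (∫ t in Set.Ioi (0 : ℝ), f t)) := by
  have hC : 0 ≤ C := by
    have := (norm_nonneg _).trans (hb 1 one_pos)
    exact nonneg_of_mul_nonneg_left this (Real.exp_pos _)
  set g : ℕ → ℝ → ℂ := fun n t => f ((⌈t * 2 ^ n⌉₊ : ℝ) / 2 ^ n) with hg
  have hgm : ∀ n, Measurable (g n) := fun n =>
    (measurable_from_nat (f := fun m : ℕ => f ((m : ℝ) / 2 ^ n))).comp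
      (Nat.measurable_ceil.comp (measurable_id.mul measurable_const))
  have hbound : Integrable (fun t => C * Real.exp (-c * t)) (volume.restrict (Set.Ioi 0)) :=
    (exp_neg_integrableOn_Ioi 0 hc).const_mul C
  have hle : ∀ n, ∀ t : ℝ, 0 < t → ‖g n t‖ ≤ C * Real.exp (-c * t) := by
    intro n t ht
    have h1 : t ≤ (⌈t * 2 ^ n⌉₊ : ℝ) / 2 ^ n := by
      rw [le_div_iff₀ (by positivity)]
      exact Nat.le_ceil _
    refine (hb _ (ht.trans_le h1)).trans ?_
    gcongr ?_ * Real.exp ?_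
    nlinarith
  have hsum : ∀ n, ∑' k : ℕ, ((1 / 2 ^ n : ℝ) : ℂ) * f (((k : ℝ) + 1) * (1 / 2 ^ n)) =
      ∫ t in Set.Ioi (0 : ℝ), g n t := by
    intro n
    have hgi : IntegrableOn (g n) (Set.Ioi 0) := by
      refine hbound.mono' (hgm n).aestronglyMeasurable ?_
      filter_upwards [ae_restrict_mem measurableSet_Ioi] with t ht using hle n t ht
    rw [← (hasSum_integral_cells hgi n).tsum_eq]
    congr 1
    ext k
    have h2n : (0 : ℝ) < 2 ^ n := by positivity
    have hkk : (k : ℝ) / 2 ^ n ≤ ((k : ℝ) + 1) / 2 ^ n := by gcongr; linarith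
    have : ∫ t in ((k : ℝ) / 2 ^ n)..((k + 1 : ℝ) / 2 ^ n), g n t =
        ∫ t in ((k : ℝ) / 2 ^ n)..((k + 1 : ℝ) / 2 ^ n), f (((k : ℝ) + 1) * (1 / 2 ^ n)) := by
      refine intervalIntegral.integral_congr_ae (Eventually.of_forall fun t ht => ?_)
      rw [Set.uIoc_of_le hkk] at ht
      have hceil : ⌈t * 2 ^ n⌉₊ = k + 1 := by
        rw [Nat.ceil_eq_iff k.succ_ne_zero]
        have h1 := (div_lt_iff₀ h2n).mp ht.1
        have h2 := (le_div_iff₀ h2n).mp ht.2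
        simpa using ⟨h1, h2⟩
      simp only [hg, hceil]
      congr 1
      push_cast
      ring
    rw [this, intervalIntegral.integral_const, Complex.real_smul]
    congr 2
    ring
  simp_rw [hsum]
  refine tendsto_integral_of_dominated_convergence (fun t => C * Real.exp (-c * t))
    (fun n => (hgm n).aestronglyMeasurable) hbound (fun n => ?_) ?_
  · filter_upwards [ae_restrict_mem measurableSet_Ioi] with t ht using hle n t ht
  · filter_upwards [ae_restrict_mem measurableSet_Ioi] with t ht
    have h1 : Tendsto (fun n : ℕ => (⌈t * 2 ^ n⌉₊ : ℝ) / 2 ^ n) atTop (𝓝 t) :=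
      (tendsto_nat_ceil_mul_div_atTop (le_of_lt ht)).comp
        (tendsto_pow_atTop_atTop_of_one_lt (one_lt_two : (1 : ℝ) < 2))
    exact ((hf.continuousAt (Ioi_mem_nhds ht)).tendsto).comp h1

theorem tendsto_riemann_exponentDensity {N : ℕ} (hN : 2 ≤ N) (hE : Even N) {S : Set ℝ}
    (hS : MeasurableSet S) (hcone : ∀ r x : ℝ, 0 < r → (r * x ∈ S ↔ x ∈ S)) {lam : ℂ}
    (hlam : 0 < lam.re) (μ : ℝ) {ν : ℝ} (hν : 0 ≤ ν) :
    Tendsto (fun n : ℕ => ∑' k : ℕ, ((1 / 2 ^ n : ℝ) : ℂ) *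
        exponentDensity N S lam μ ν (((k : ℝ) + 1) * (1 / 2 ^ n))) atTop
      (𝓝 (spitzerExponent N S lam μ ν)) :=
  tendsto_riemann_sum (continuousOn_exponentDensity hN hE hS hcone lam μ ν) hlam
    fun _ ht => norm_exponentDensity_le hN hE S lam μ hν ht

/-! ### The transform at a fixed step size -/

theorem symbol_pow (N : ℕ) (t μ : ℝ) (k : ℕ) :
    symbol N ((k : ℝ) * t) μ = symbol N t μ ^ k := by
  rw [symbol, symbol, ← Complex.ofReal_pow, ← Real.exp_nat_mul]
  congr 2
  ring

theorem walkTransform_Iio_zero (N n : ℕ) (w μ : ℝ) :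
    walkTransform N n w (Set.Iio 0) 0 μ = 0 := by
  simp [walkTransform, pathOf]

/-- Spitzer's identity for the pseudo-random walk. -/
theorem walkTransform_spitzer {N : ℕ} (hN : 2 ≤ N) (hE : Even N) (n : ℕ) {w : ℝ} (hw : 0 < w)
    (hw1 : w < 1) (μ : ℝ) (k : ℕ) :
    (1 - (w : ℂ)⁻¹) * walkTransform N n w (Set.Ici 0) (k + 1) μ =
        expCoeff (fun j => (((w ^ (j + 1) - 1 : ℝ) : ℂ) *
          partTransform N (Set.Ici 0) (((j : ℝ) + 1) * (1 / 2 ^ n)) μ)) (k + 1) ∧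
      (1 - (w : ℂ)) * walkTransform N n w (Set.Iio 0) (k + 1) μ =
        expCoeff (fun j => (((1 - w ^ (j + 1) : ℝ) : ℂ) *
          partTransform N (Set.Iio 0) (((j : ℝ) + 1) * (1 / 2 ^ n)) μ)) (k + 1) := by
  have hδ : ∀ j : ℕ, 0 < ((j : ℝ) + 1) * (1 / 2 ^ n) := fun j => by positivity
  obtain ⟨h1, h2⟩ := spitzer_identity
    (signedCharFun (Set.Ici 0) measurableSet_Ici add_mem_Ici_zero)
    (signedCharFun (Set.Iio 0) measurableSet_Iio add_mem_Iio_zero)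
    (signedCharFun_disjoint disjoint_Ici_Iio) (φ := symbol N (1 / 2 ^ n)) hw.ne' hw1.ne
    (a := fun j => partTransform N (Set.Ici 0) (((j : ℝ) + 1) * (1 / 2 ^ n)))
    (b := fun j => partTransform N (Set.Iio 0) (((j : ℝ) + 1) * (1 / 2 ^ n)))
    (u := walkTransform N n w (Set.Ici 0)) (v := walkTransform N n w (Set.Iio 0))
    (fun j => partTransform_mem hN hE measurableSet_Ici add_mem_Ici_zero (hδ j))
    (fun j => partTransform_mem hN hE measurableSet_Iio add_mem_Iio_zero (hδ j))
    (fun j => by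
      ext ξ
      rw [Pi.add_apply, partTransform_add hN hE (hδ j), Pi.pow_apply, ← symbol_pow]
      push_cast
      rfl)
    (fun j => walkTransform_mem hN hE n hw hw1.le measurableSet_Ici add_mem_Ici_zero _)
    (fun j => walkTransform_mem hN hE n hw hw1.le measurableSet_Iio add_mem_Iio_zero _)
    (by ext ξ; exact walkTransform_zero hN hE n hw hw1.le ξ)
    (fun j => by
      ext ξ
      have := walkTransform_succ hN hE n hw hw1.le j ξ
      simpa using this) k
  have e1 := congrFun h1 μ
  have e2 := congrFun h2 μ
  rw [expCoeff_apply] at e1 e2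
  simp only [Pi.smul_apply, Complex.real_smul] at e1 e2
  push_cast at e1 e2 ⊢
  exact ⟨e1, e2⟩

/-- The Riemann sum of step `1 / 2 ^ n` for `spitzerExponent`. -/
noncomputable def discreteExponent (N : ℕ) (S : Set ℝ) (lam : ℂ) (μ ν : ℝ) (n : ℕ) : ℂ :=
  ∑' k : ℕ, ((1 / 2 ^ n : ℝ) : ℂ) * exponentDensity N S lam μ ν (((k : ℝ) + 1) * (1 / 2 ^ n))

theorem exponentDensity_grid (N : ℕ) (S : Set ℝ) (lam : ℂ) (μ ν : ℝ) (n k : ℕ) :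
    ((1 / 2 ^ n : ℝ) : ℂ) * exponentDensity N S lam μ ν (((k : ℝ) + 1) * (1 / 2 ^ n)) =
      (((1 - Real.exp (-(ν * (1 / 2 ^ n))) ^ (k + 1) : ℝ) : ℂ) *
        partTransform N S (((k : ℝ) + 1) * (1 / 2 ^ n)) μ) *
        Complex.exp (-(lam * (1 / 2 ^ n))) ^ (k + 1) / (k + 1) := by
  have h1 : Complex.exp (-(lam * (1 / 2 ^ n))) ^ (k + 1) =
      Complex.exp (-(lam * ((((k : ℝ) + 1) * (1 / 2 ^ n) : ℝ) : ℂ))) := by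
    rw [← Complex.exp_nat_mul]
    congr 1
    push_cast
    ring
  have h2 : Real.exp (-(ν * (1 / 2 ^ n))) ^ (k + 1) =
      Real.exp (-(ν * (((k : ℝ) + 1) * (1 / 2 ^ n)))) := by
    rw [← Real.exp_nat_mul]
    congr 1
    push_cast
    ring
  have hk : (k : ℂ) + 1 ≠ 0 := by exact_mod_cast k.succ_ne_zero
  have h2n : (2 : ℂ) ^ n ≠ 0 := pow_ne_zero _ two_ne_zero
  rw [exponentDensity, h1, h2, Complex.ofReal_div]
  push_cast
  field_simp

theorem norm_exp_step_lt_one {lam : ℂ} (hlam : 0 < lam.re) (n : ℕ) :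
    ‖Complex.exp (-(lam * (1 / 2 ^ n)))‖ < 1 := by
  have h : (1 / 2 ^ n : ℂ) = ((1 / 2 ^ n : ℝ) : ℂ) := by push_cast; rfl
  have hn : (0 : ℝ) < 1 / 2 ^ n := by positivity
  rw [h, norm_exp_neg_mul, Real.exp_lt_one_iff]
  nlinarith

theorem norm_weight_mul_partTransform_le {N : ℕ} (hN : 2 ≤ N) (hE : Even N) (S : Set ℝ) {w : ℝ}
    (hw : 0 < w) (hw1 : w < 1) {t : ℝ} (ht : 0 < t) (μ : ℝ) (k : ℕ) :
    ‖((1 - w ^ (k + 1) : ℝ) : ℂ) * partTransform N S t μ‖ ≤ ∫ x, ‖kernel N 1 x‖ := by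
  have h1 : w ^ (k + 1) ≤ 1 := pow_le_one₀ hw.le hw1.le
  have h2 : 0 < w ^ (k + 1) := by positivity
  rw [norm_mul, Complex.norm_real, Real.norm_of_nonneg (by linarith)]
  have h3 := norm_partTransform_le hN hE S ht μ
  nlinarith [norm_nonneg (partTransform N S t μ)]

theorem hasSum_succ_of_expCoeff {a : ℕ → ℂ} {C : ℝ} (ha : ∀ k, ‖a k‖ ≤ C) {z : ℂ} (hz : ‖z‖ < 1)
    {c : ℂ} (hc : c ≠ 0) {u : ℕ → ℂ} (hu : ∀ k, c * u (k + 1) = expCoeff a (k + 1)) :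
    HasSum (fun k => u (k + 1) * z ^ (k + 1))
      ((Complex.exp (∑' k : ℕ, a k * z ^ (k + 1) / (k + 1)) - 1) / c) := by
  have h := (hasSum_nat_add_iff' 1).mpr (hasSum_expCoeff ha hz)
  simp only [Finset.sum_range_one, expCoeff_zero, pow_zero, mul_one] at h
  refine Eq.mpr (congrArg (fun g => HasSum g _) (funext fun k => ?_)) (h.div_const c)
  rw [← hu]
  field_simp

/-- The closed form of the discrete transform, as an absolutely convergent series. -/
theorem hasSum_expectation_slice {N : ℕ} (hN : 2 ≤ N) (hE : Even N) {lam : ℂ} (hlam : 0 < lam.re)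
    (μ : ℝ) {ν : ℝ} (hν : 0 < ν) (n : ℕ) :
    HasSum (fun k => expectation N n (slice lam μ ν n k))
      (holdingFactor lam ν n 0 * ((Complex.exp (-discreteExponent N (Set.Ici 0) lam μ ν n) - 1) /
          (1 - ((Real.exp (-(ν * (1 / 2 ^ n))) : ℝ) : ℂ)⁻¹)) +
        Real.exp (-(ν * (1 / 2 ^ n))) * holdingFactor lam ν n (-1) *
          ((Complex.exp (discreteExponent N (Set.Iio 0) lam μ ν n) - 1) /
            (1 - ((Real.exp (-(ν * (1 / 2 ^ n))) : ℝ) : ℂ))) + holdingFactor lam ν n 0) := by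
  set w := Real.exp (-(ν * (1 / 2 ^ n))) with hw
  set z := Complex.exp (-(lam * (1 / 2 ^ n))) with hz
  have hδ : ∀ j : ℕ, 0 < ((j : ℝ) + 1) * (1 / 2 ^ n) := fun j => by positivity
  have hw0 : 0 < w := Real.exp_pos _
  have hw1 : w < 1 := by
    rw [hw, Real.exp_lt_one_iff]
    have : 0 < ν * (1 / 2 ^ n) := by positivity
    linarith
  have hz1 : ‖z‖ < 1 := norm_exp_step_lt_one hlam n
  have hc2 : (1 : ℂ) - w ≠ 0 := by
    rw [← Complex.ofReal_one, ← Complex.ofReal_sub]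
    exact_mod_cast (sub_pos.mpr hw1).ne'
  have hc1 : (1 : ℂ) - (w : ℂ)⁻¹ ≠ 0 := by
    have h0 : (w : ℂ) ≠ 0 := by exact_mod_cast hw0.ne'
    intro h
    apply hc2
    field_simp at h
    linear_combination -h
  have hR := hasSum_succ_of_expCoeff (fun j => by
      rw [← neg_sub, Complex.ofReal_neg, neg_mul, norm_neg]
      exact norm_weight_mul_partTransform_le hN hE (Set.Ici 0) hw0 hw1 (hδ j) μ j) hz1 hc1
    (u := fun k => walkTransform N n w (Set.Ici 0) k μ)
    fun k => (walkTransform_spitzer hN hE n hw0 hw1 μ k).1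
  have hL := hasSum_succ_of_expCoeff (fun j =>
      norm_weight_mul_partTransform_le hN hE (Set.Iio 0) hw0 hw1 (hδ j) μ j) hz1 hc2
    (u := fun k => walkTransform N n w (Set.Iio 0) k μ)
    fun k => (walkTransform_spitzer hN hE n hw0 hw1 μ k).2
  have e1 : ∑' k : ℕ, ((w ^ (k + 1) - 1 : ℝ) : ℂ) *
      partTransform N (Set.Ici 0) (((k : ℝ) + 1) * (1 / 2 ^ n)) μ * z ^ (k + 1) / (k + 1) =
      -discreteExponent N (Set.Ici 0) lam μ ν n := by
    rw [discreteExponent, ← tsum_neg]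
    congr 1
    ext k
    rw [exponentDensity_grid, ← neg_sub, Complex.ofReal_neg]
    ring
  have e2 : ∑' k : ℕ, ((1 - w ^ (k + 1) : ℝ) : ℂ) *
      partTransform N (Set.Iio 0) (((k : ℝ) + 1) * (1 / 2 ^ n)) μ * z ^ (k + 1) / (k + 1) =
      discreteExponent N (Set.Iio 0) lam μ ν n := by
    rw [discreteExponent]
    congr 1
    ext k
    rw [exponentDensity_grid]
  rw [e1] at hR
  rw [e2] at hL
  have h0 : expectation N n (slice lam μ ν n 0) = holdingFactor lam ν n 0 := by
    have hz0 := walkTransform_zero hN hE n hw0 hw1.le μ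
    rw [walkTransform_Iio_zero, add_zero] at hz0
    rw [expectation_slice hN hE lam μ hν, ← hw, walkTransform_Iio_zero, hz0]
    simp
  have h := (hR.mul_left (holdingFactor lam ν n 0)).add
    (hL.mul_left (w * holdingFactor lam ν n (-1)))
  have hs : (fun k => holdingFactor lam ν n 0 *
        (walkTransform N n w (Set.Ici 0) (k + 1) μ * z ^ (k + 1)) +
      w * holdingFactor lam ν n (-1) *
        (walkTransform N n w (Set.Iio 0) (k + 1) μ * z ^ (k + 1))) =
      fun k => expectation N n (slice lam μ ν n (k + 1)) := by
    ext k
    rw [expectation_slice hN hE lam μ hν]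
    ring
  rw [hs] at h
  have := (hasSum_nat_add_iff (f := fun k => expectation N n (slice lam μ ν n k)) 1).mp h
  rwa [Finset.sum_range_one, h0] at this

theorem isDiscreteExpansion_laplaceFunctional {N : ℕ} (hN : 2 ≤ N) (hE : Even N) {lam : ℂ}
    (hlam : 0 < lam.re) (μ : ℝ) {ν : ℝ} (hν : 0 < ν) (n : ℕ) :
    IsDiscreteExpansion N n (laplaceFunctional lam μ ν n) (slice lam μ ν n) where
  tame := isTame_slice hlam μ hν n
  integrable k := integrable_mul_density hN hE n (isTame_slice hlam μ hν n k)
  hasSum := hasSum_slice hlam μ hν n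
  summable := (hasSum_expectation_slice hN hE hlam μ hν n).summable.norm

/-! ### The limit of vanishing step size -/

theorem tendsto_step : Tendsto (fun n : ℕ => (1 / 2 ^ n : ℝ)) atTop (𝓝[≠] 0) := by
  refine tendsto_nhdsWithin_iff.mpr ⟨?_, Eventually.of_forall fun n => by simp⟩
  have := tendsto_pow_atTop_nhds_zero_of_lt_one (r := (1 / 2 : ℝ)) (by norm_num) (by norm_num)
  simpa using this

theorem tendsto_div_step {F : ℝ → ℂ} {F' : ℂ} (hF : HasDerivAt F F' 0) (h0 : F 0 = 0) :
    Tendsto (fun n : ℕ => F (1 / 2 ^ n) / ((1 / 2 ^ n : ℝ) : ℂ)) atTop (𝓝 F') := by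
  have h := (hasDerivAt_iff_tendsto_slope.mp hF).comp tendsto_step
  refine h.congr fun n => ?_
  simp only [Function.comp_apply, slope, vsub_eq_sub, h0, sub_zero, Complex.real_smul,
    Complex.ofReal_inv]
  exact (div_eq_inv_mul _ _).symm

theorem tendsto_holdingFactor_div (lam : ℂ) (ν x : ℝ) :
    Tendsto (fun n : ℕ => holdingFactor lam ν n x / ((1 / 2 ^ n : ℝ) : ℂ)) atTop (𝓝 1) := by
  set a : ℂ := lam + if 0 ≤ x then (ν : ℂ) else 0 with ha
  have hc : Continuous fun s : ℝ => Complex.exp (-(a * s)) := by fun_prop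
  have h := (hc.integral_hasStrictDerivAt 0 0).hasDerivAt
  rw [Complex.ofReal_zero, mul_zero, neg_zero, Complex.exp_zero] at h
  exact tendsto_div_step h (by simp)

theorem tendsto_one_sub_exp_div (x : ℝ) :
    Tendsto (fun n : ℕ => (1 - ((Real.exp (-(x * (1 / 2 ^ n))) : ℝ) : ℂ)) / ((1 / 2 ^ n : ℝ) : ℂ))
      atTop (𝓝 x) := by
  have h0 : HasDerivAt (fun t : ℝ => -(x * t)) (-x) 0 := by
    simpa using ((hasDerivAt_id (0 : ℝ)).const_mul x).fun_neg
  have h : HasDerivAt (fun t : ℝ => 1 - ((Real.exp (-(x * t)) : ℝ) : ℂ)) x 0 := by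
    refine (h0.exp.ofReal_comp.const_sub 1).congr_deriv ?_
    simp
  exact tendsto_div_step h (by simp)

/-- The factors `1 - w⁻¹ ~ -ν δ` and `1 - w ~ ν δ` in the denominators cancel the lengths of the
cells, which leaves the difference of the two exponentials over `ν`. -/
theorem tendsto_discreteTransform {N : ℕ} (hN : 2 ≤ N) (hE : Even N) {lam : ℂ} (hlam : 0 < lam.re)
    (μ : ℝ) {ν : ℝ} (hν : 0 < ν) :
    Tendsto (fun n => discreteTransform N lam μ ν n) atTop
      (𝓝 ((Complex.exp (spitzerExponent N (Set.Iio 0) lam μ ν) -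
        Complex.exp (-spitzerExponent N (Set.Ici 0) lam μ ν)) / ν)) := by
  have hν0 : (ν : ℂ) ≠ 0 := by exact_mod_cast hν.ne'
  have hp := tendsto_riemann_exponentDensity hN hE measurableSet_Ici mul_mem_Ici_iff hlam μ hν.le
  have hm := tendsto_riemann_exponentDensity hN hE measurableSet_Iio mul_mem_Iio_iff hlam μ hν.le
  have hδ : Tendsto (fun n : ℕ => ((1 / 2 ^ n : ℝ) : ℂ)) atTop (𝓝 0) := by
    have := (Complex.continuous_ofReal.tendsto 0).comp (tendsto_step.mono_right nhdsWithin_le_nhds)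
    rw [Complex.ofReal_zero] at this
    exact this
  have hne : ∀ n : ℕ, ((1 / 2 ^ n : ℝ) : ℂ) ≠ 0 := fun n => by
    exact_mod_cast (by positivity : (1 / 2 ^ n : ℝ) ≠ 0)
  have hcp := tendsto_holdingFactor_div lam ν 0
  have hcm := tendsto_holdingFactor_div lam ν (-1)
  have h1 := tendsto_one_sub_exp_div ν
  have h2 := tendsto_one_sub_exp_div (-ν)
  rw [Complex.ofReal_neg] at h2
  have hw : Tendsto (fun n : ℕ => ((Real.exp (-(ν * (1 / 2 ^ n))) : ℝ) : ℂ)) atTop (𝓝 1) := by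
    have := (h1.mul hδ).const_sub 1
    rw [mul_zero, sub_zero] at this
    refine this.congr fun n => ?_
    rw [div_mul_cancel₀ _ (hne n)]
    ring
  have hcp0 : Tendsto (fun n => holdingFactor lam ν n 0) atTop (𝓝 0) := by
    have := hcp.mul hδ
    rw [mul_zero] at this
    exact this.congr fun n => div_mul_cancel₀ _ (hne n)
  have hlim := (((hcp.div h2 (neg_ne_zero.mpr hν0)).mul ((hp.neg.cexp).sub_const 1)).add
    (((hw.mul hcm).div h1 hν0).mul ((hm.cexp).sub_const 1))).add hcp0
  have hval : (1 / -(ν : ℂ) * (Complex.exp (-spitzerExponent N (Set.Ici 0) lam μ ν) - 1) +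
      1 * 1 / ν * (Complex.exp (spitzerExponent N (Set.Iio 0) lam μ ν) - 1) + 0) =
      (Complex.exp (spitzerExponent N (Set.Iio 0) lam μ ν) -
        Complex.exp (-spitzerExponent N (Set.Ici 0) lam μ ν)) / ν := by
    field_simp
    ring
  rw [hval] at hlim
  refine hlim.congr fun n => ?_
  rw [discreteTransform, (hasSum_expectation_slice hN hE hlam μ hν n).tsum_eq]
  have hinv : ((Real.exp (-(ν * (1 / 2 ^ n))) : ℝ) : ℂ)⁻¹ =
      ((Real.exp (-(-ν * (1 / 2 ^ n))) : ℝ) : ℂ) := by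
    rw [← Complex.ofReal_inv, ← Real.exp_neg]
    congr 2
    ring
  simp only [hinv, discreteExponent, Pi.div_apply]
  rw [div_div_div_cancel_right₀ (hne n), mul_div_assoc' _ _ ((1 / 2 ^ n : ℝ) : ℂ),
    div_div_div_cancel_right₀ (hne n)]
  ring

end PseudoProcess

theorem mainTheorem1 (N : ℕ) (hN : 2 ≤ N) (hNeven : Even N)
    (lam : ℂ) (hlam : 0 < lam.re) (μ ν : ℝ) (hν : 0 < ν) :
    (∀ (n : ℕ) (x : ℕ → ℝ),
      IntegrableOn (PseudoProcess.integrand lam μ ν n x) (Set.Ioi 0)) ∧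
    (∀ n : ℕ, PseudoProcess.IsDiscreteExpansion N n
      (PseudoProcess.laplaceFunctional lam μ ν n) (PseudoProcess.slice lam μ ν n)) ∧
    Tendsto (fun n : ℕ => PseudoProcess.discreteTransform N lam μ ν n) atTop
      (𝓝 (1 / ((∏ θ ∈ PseudoProcess.rootsJ N,
            ((lam + ν) ^ (1 / (N : ℂ)) - Complex.I * μ * θ)) *
          ∏ θ ∈ PseudoProcess.rootsK N,
            (lam ^ (1 / (N : ℂ)) - Complex.I * μ * θ)))) := by
  refine ⟨PseudoProcess.integrableOn_integrand hlam μ hν,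
    PseudoProcess.isDiscreteExpansion_laplaceFunctional hN hNeven hlam μ hν, ?_⟩
  have hre : 0 < (lam + ν).re := by
    rw [Complex.add_re, Complex.ofReal_re]; linarith
  have hν0 : (ν : ℂ) ≠ 0 := by exact_mod_cast hν.ne'
  have hJ := PseudoProcess.exp_spitzerExponent hN hNeven measurableSet_Ici
    PseudoProcess.mul_mem_Ici_iff hlam μ hν.le (T := PseudoProcess.rootsJ N)
    (fun θ hθ => ((PseudoProcess.mem_rootsJ hN).mp hθ).1)
    (fun s hs => (PseudoProcess.partLaplace_eq hN hNeven hs μ).1)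
  have hK := PseudoProcess.exp_spitzerExponent hN hNeven measurableSet_Iio
    PseudoProcess.mul_mem_Iio_iff hlam μ hν.le (T := PseudoProcess.rootsK N)
    (fun θ hθ => ((PseudoProcess.mem_rootsK hN).mp hθ).1)
    (fun s hs => (PseudoProcess.partLaplace_eq hN hNeven hs μ).2)
  have hAJ : ∏ θ ∈ PseudoProcess.rootsJ N, (lam ^ (1 / (N : ℂ)) - Complex.I * μ * θ) ≠ 0 :=
    Finset.prod_ne_zero_iff.mpr fun θ hθ => PseudoProcess.root_sub_ne_zero hN hNeven hlam μ
      ((PseudoProcess.mem_rootsJ hN).mp hθ).1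
  have hAK : ∏ θ ∈ PseudoProcess.rootsK N, (lam ^ (1 / (N : ℂ)) - Complex.I * μ * θ) ≠ 0 :=
    Finset.prod_ne_zero_iff.mpr fun θ hθ => PseudoProcess.root_sub_ne_zero hN hNeven hlam μ
      ((PseudoProcess.mem_rootsK hN).mp hθ).1
  have hBJ : ∏ θ ∈ PseudoProcess.rootsJ N,
      ((lam + ν) ^ (1 / (N : ℂ)) - Complex.I * μ * θ) ≠ 0 :=
    Finset.prod_ne_zero_iff.mpr fun θ hθ => PseudoProcess.root_sub_ne_zero hN hNeven hre μ
      ((PseudoProcess.mem_rootsJ hN).mp hθ).1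
  have hA := PseudoProcess.prod_rootsJ_mul_prod_rootsK hN hNeven
    fun θ => lam ^ (1 / (N : ℂ)) - Complex.I * μ * θ
  have hB := PseudoProcess.prod_rootsJ_mul_prod_rootsK hN hNeven
    fun θ => (lam + ν) ^ (1 / (N : ℂ)) - Complex.I * μ * θ
  rw [PseudoProcess.prod_root_sub hN hNeven] at hA hB
  convert PseudoProcess.tendsto_discreteTransform hN hNeven hlam μ hν using 2
  -- over all roots the products at `λ + ν` and `λ` differ by `ν`, which cancels the denominator
  have eJ := eq_div_of_mul_eq hAJ hJ
  have eK := eq_div_of_mul_eq hAK hK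
  rw [Complex.exp_neg, eJ, eK]
  field_simp
  linear_combination hA - hB
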